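/- Let $H^s$, $L^s$ denote the Hardy and Lebesgue spaces of the unit circle $\mathbb T$, let $\overline{H^s_0}=\{\overline f: f\in H^s,\ f(0)=0\}$, let $n\in\mathbb N$, $p\in(2,\infty]$, $\frac1q=\frac12+\frac1p$ (so $1<q\le 2$), and for $1<s<\infty$ let $P_{s+}:(L^s)^n\to(H^s)^n$ be the Riesz projection, i.e. the projection along $(\overline{H^s_0})^n$. Let $\Theta$ be an $n\times n$ matrix inner function (entries in $H^\infty$, unitary a.e. on $\mathbb T$), let $G$ be an $n\times n$ matrix with entries in $L^p$, and put $$\mathcal G=\begin{pmatrix}\Theta^*&0\\ G&\Theta\end{pmatrix},\qquad T_{\mathcal G}\begin{pmatrix}f_1\\f_2\end{pmatrix}=\begin{pmatrix}P_{2+}(\Theta^*f_1)\\ P_{q+}(Gf_1+\Theta f_2)\end{pmatrix},\qquad f_1\in(H^2)^n,\ f_2\in(H^q)^n .$$ Let $P_n(f_1,f_2)=f_1$ be the projection onto the first $n$ coordinates, let $S^*f=(f-f(0))/z$ on $(H^2)^n$, and let $W_1,\dots,W_r\in\ker T_{\mathcal G}$ be such that $W_1(0),\dots,W_r(0)$ form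 a basis of $\{F(0):F\in\ker T_{\mathcal G}\}\subseteq\mathbb C^{2n}$. Put $$M=P_n(\ker T_{\mathcal G}),\qquad D=\Big(\frac{\operatorname{span}\{P_nW_1,\dots,P_nW_r\}}{z}\Big)\cap (H^2)^n .$$ Then $M$ is nearly $S^*$-invariant with finite-dimensional defect space $D$: $M$ is a closed subspace of $(H^2)^n$, $\dim D<\infty$, and every $f\in M$ with $f(0)=0$ satisfies $S^*f\in M+D$. If $\Theta$ is pure, i.e. $\|\Theta(0)\|<1$, the sum $M+D$ is direct. In general the defect space may be replaced by one orthogonal to $M$: there is a subspace $D'\subseteq (H^2)^n$ with $D'\perp M$, $\dim D'\le\dim D$ and $M\oplus D'=M+D$; in particular $S^*f\in M\oplus D'$ for every $f\in M$ with $f(0)=0$. -/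

import Mathlib

open MeasureTheory
open scoped ENNReal Matrix

noncomputable section

namespace MTTO

/-- Normalised arc length on the unit circle. The circle is parametrised by `x ↦ exp (2 π i x)`,
`x ∈ ℝ / ℤ`, so that `fourier k` is the monomial `z ^ k` restricted to the circle. -/
abbrev arcLength : Measure UnitAddCircle := AddCircle.haarAddCircle

/-- The scalar space `L^q` of the unit circle. -/
abbrev CircleLp (q : ℝ≥0∞) : Type := Lp ℂ q arcLength

/-- `(L^q)^n`: columns of length `n` with entries in `L^q`. -/
abbrev ColLp (q : ℝ≥0∞) (n : ℕ) : Type := Fin n → CircleLp q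

/-- `(L^2)^n` with its Hilbert space structure. -/
abbrev ColL2 (n : ℕ) : Type := PiLp 2 fun _ : Fin n => CircleLp 2

/-- Pointwise product `L^p × L^s → L^q`, where `1/p + 1/s = 1/q`. -/
def mulLp {p s q : ℝ≥0∞} [ENNReal.HolderTriple p s q] (g : CircleLp p) (f : CircleLp s) :
    CircleLp q :=
  g • f

lemma mulLp_add {p s q : ℝ≥0∞} [ENNReal.HolderTriple p s q] (g : CircleLp p)
    (f f' : CircleLp s) : (mulLp g (f + f') : CircleLp q) = mulLp g f + mulLp g f' :=
  Lp.add_smul g f f'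

lemma mulLp_smul {p s q : ℝ≥0∞} [ENNReal.HolderTriple p s q] (g : CircleLp p)
    (c : ℂ) (f : CircleLp s) : (mulLp g (c • f) : CircleLp q) = c • mulLp g f :=
  (Lp.smul_comm c g f).symm

/-- Product of a matrix with entries in `L^p` and a column with entries in `L^s`. -/
def matMul {p s q : ℝ≥0∞} [ENNReal.HolderTriple p s q] {n : ℕ}
    (A : Matrix (Fin n) (Fin n) (CircleLp p)) : ColLp s n →ₗ[ℂ] ColLp q n where
  toFun f := fun i => ∑ j, mulLp (A i j) (f j)
  map_add' f f' := by
    funext i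
    simp [mulLp_add, Finset.sum_add_distrib]
  map_smul' c f := by
    funext i
    simp [mulLp_smul, Finset.smul_sum]

lemma star_add_circleLp (q : ℝ≥0∞) (f g : CircleLp q) : star (f + g) = star f + star g := by
  apply Lp.ext
  filter_upwards [Lp.coeFn_star (f + g), Lp.coeFn_add f g, Lp.coeFn_star f, Lp.coeFn_star g,
    Lp.coeFn_add (star f) (star g)] with x h1 h2 h3 h4 h5
  rw [h1, h5, Pi.star_apply, h2, Pi.add_apply, Pi.add_apply, h3, h4, star_add,
    Pi.star_apply, Pi.star_apply]

lemma star_smul_circleLp (q : ℝ≥0∞) (c : ℂ) (f : CircleLp q) : star (c • f) = star c • star f := by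
  apply Lp.ext
  filter_upwards [Lp.coeFn_star (c • f), Lp.coeFn_smul c f, Lp.coeFn_star f,
    Lp.coeFn_smul (star c) (star f)] with x h1 h2 h3 h4
  rw [h1, h4, Pi.star_apply, h2, Pi.smul_apply, Pi.smul_apply, h3, Pi.star_apply,
    smul_eq_mul, smul_eq_mul, star_mul']

section Hardy

variable (q : ℝ≥0∞) [Fact (1 ≤ q)]

/-- The `k`-th Fourier coefficient, as a linear functional on `L^q`, `1 ≤ q ≤ ∞`. -/
def coeff (k : ℤ) : CircleLp q →ₗ[ℂ] ℂ where
  toFun f := fourierCoeff (f : UnitAddCircle → ℂ) k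
  map_add' f g := by
    have hf : Integrable f arcLength := (Lp.memLp f).integrable Fact.out
    have hg : Integrable g arcLength := (Lp.memLp g).integrable Fact.out
    rw [fourierCoeff_congr_ae (Lp.coeFn_add f g), fourierCoeff.add hf hg]
    rfl
  map_smul' c f := by
    rw [fourierCoeff_congr_ae (Lp.coeFn_smul c f), fourierCoeff.const_smul]
    rfl

/-- The Hardy space `H^q` of the circle: the functions in `L^q` whose Fourier coefficients of
negative index vanish. -/
def hardy : Submodule ℂ (CircleLp q) := ⨅ k : {k : ℤ // k < 0}, LinearMap.ker (coeff q k)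

/-- The value at the origin of the analytic function on the disc with boundary function
`f ∈ H^q`; it is the Fourier coefficient of index `0`. -/
abbrev atZero : CircleLp q →ₗ[ℂ] ℂ := coeff q 0

/-- The value at the origin of a column. -/
def colAtZero (n : ℕ) : ColLp q n →ₗ[ℂ] (Fin n → ℂ) :=
  LinearMap.pi fun i => atZero q ∘ₗ LinearMap.proj i

/-- `(H^q)^n`. -/
def colHardy (n : ℕ) : Submodule ℂ (ColLp q n) := Submodule.pi Set.univ fun _ => hardy q

/-- The space `conj (H^q_0) = {conj f : f ∈ H^q, f(0) = 0}`. -/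
def conjHardyZero : Submodule ℂ (CircleLp q) where
  carrier := {g | ∃ f ∈ hardy q, atZero q f = 0 ∧ g = star f}
  zero_mem' := by
    refine ⟨0, zero_mem _, map_zero _, ?_⟩
    have h := star_smul_circleLp q 0 0
    simpa using h.symm
  add_mem' := by
    rintro _ _ ⟨f, hf, hf0, rfl⟩ ⟨g, hg, hg0, rfl⟩
    exact ⟨f + g, add_mem hf hg, by rw [map_add, hf0, hg0, add_zero],
      (star_add_circleLp q f g).symm⟩
  smul_mem' := by
    rintro c _ ⟨f, hf, hf0, rfl⟩
    exact ⟨star c • f, Submodule.smul_mem _ _ hf, by rw [map_smul, hf0, smul_zero],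
      by rw [star_smul_circleLp, star_star]⟩

/-- `(conj (H^q_0))^n`. -/
def colConjHardyZero (n : ℕ) : Submodule ℂ (ColLp q n) :=
  Submodule.pi Set.univ fun _ => conjHardyZero q

/-- `(f, g)` lies in the graph of the Riesz projection `P_{q+} : (L^q)^n → (H^q)^n`, that is
`g = P_{q+} f`: here `P_{q+}` is the projection onto the first summand of
`(L^q)^n = (H^q)^n ⊕ (conj (H^q_0))^n`, a direct decomposition for `1 < q < ∞`. -/
def rieszGraph (n : ℕ) : Submodule ℂ (ColLp q n × ColLp q n) where
  carrier := {x | x.2 ∈ colHardy q n ∧ x.1 - x.2 ∈ colConjHardyZero q n}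
  zero_mem' := by simp [zero_mem]
  add_mem' := by
    rintro x y ⟨hx, hx'⟩ ⟨hy, hy'⟩
    refine ⟨add_mem hx hy, ?_⟩
    have h := add_mem hx' hy'
    rwa [sub_add_sub_comm] at h
  smul_mem' := by
    rintro c x ⟨hx, hx'⟩
    refine ⟨Submodule.smul_mem _ c hx, ?_⟩
    have h := Submodule.smul_mem _ c hx'
    rwa [smul_sub] at h

end Hardy

/-- The columns of `(L^2)^n`, without the Hilbert space structure. -/
def ofColL2 (n : ℕ) : ColL2 n →ₗ[ℂ] ColLp 2 n :=
  (WithLp.linearEquiv 2 ℂ (Fin n → CircleLp 2)).toLinearMap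

/-- `(H^2)^n` as a subspace of the Hilbert space `(L^2)^n`. -/
def colH2 (n : ℕ) : Submodule ℂ (ColL2 n) := (colHardy 2 n).comap (ofColL2 n)

/-- The value `f(0) ∈ ℂ^n` of `f ∈ (H^2)^n`. -/
def colH2AtZero (n : ℕ) : ColL2 n →ₗ[ℂ] (Fin n → ℂ) := colAtZero 2 n ∘ₗ ofColL2 n

/-- Division by `z` on `(L^2)^n`. -/
def divZ (n : ℕ) : ColL2 n →ₗ[ℂ] ColL2 n where
  toFun f := WithLp.toLp 2 fun i => mulLp (fourierLp (T := 1) ∞ (-1)) (f i)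
  map_add' f g := by
    ext1 i
    exact mulLp_add _ _ _
  map_smul' c f := by
    ext1 i
    exact mulLp_smul _ _ _

/-- The backward shift `S^* f = (f - f(0)) / z`. -/
def backwardShift (n : ℕ) (f : ColL2 n) : ColL2 n :=
  divZ n (f - WithLp.toLp 2 fun i => Lp.const 2 arcLength (colH2AtZero n f i))

/-- `Θ` is an `n`-by-`n` inner function: its entries lie in `H^∞` and its boundary values are
unitary almost everywhere. -/
structure IsInner {n : ℕ} (Θ : Matrix (Fin n) (Fin n) (CircleLp ∞)) : Prop where
  entry_mem : ∀ i j, Θ i j ∈ hardy ∞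
  unitary : ∀ᵐ x ∂arcLength,
    (Matrix.of fun i j => (Θ i j : UnitAddCircle → ℂ) x) ∈ Matrix.unitaryGroup (Fin n) ℂ

/-- `Θ` is pure: `‖Θ(0)‖ < 1` for the operator norm on `ℂ^n`. -/
def IsPure {n : ℕ} (Θ : Matrix (Fin n) (Fin n) (CircleLp ∞)) : Prop :=
  ‖Matrix.toEuclideanCLM (n := Fin n) (𝕜 := ℂ) (Matrix.of fun i j => atZero ∞ (Θ i j))‖ < 1

section Toeplitz

variable {n : ℕ} (p q : ℝ≥0∞) [ENNReal.HolderTriple p 2 q] [Fact (1 ≤ q)]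
  (Θ : Matrix (Fin n) (Fin n) (CircleLp ∞)) (G : Matrix (Fin n) (Fin n) (CircleLp p))

/-- The first row `f ↦ Θ^* f₁` of multiplication by the block matrix `[Θ^*, 0; G, Θ]`, on
`(L^2)^n × (L^q)^n`. -/
def blockMulFst : (ColL2 n × ColLp q n) →ₗ[ℂ] ColLp 2 n :=
  matMul (s := 2) Θᴴ ∘ₗ ofColL2 n ∘ₗ LinearMap.fst ℂ _ _

/-- The second row `f ↦ G f₁ + Θ f₂` of multiplication by the block matrix `[Θ^*, 0; G, Θ]`. -/
def blockMulSnd : (ColL2 n × ColLp q n) →ₗ[ℂ] ColLp q n :=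
  matMul G ∘ₗ ofColL2 n ∘ₗ LinearMap.fst ℂ _ _ + matMul Θ ∘ₗ LinearMap.snd ℂ _ _

/-- The graph of the Toeplitz operator with symbol `[Θ^*, 0; G, Θ]`,
`(f₁, f₂) ↦ (P_{2+} (Θ^* f₁), P_{q+} (G f₁ + Θ f₂))`, with domain `(H^2)^n × (H^q)^n`. -/
def toeplitzGraph : Submodule ℂ ((ColL2 n × ColLp q n) × (ColL2 n × ColLp q n)) where
  carrier := {x | x.1.1 ∈ colH2 n ∧ x.1.2 ∈ colHardy q n ∧
    (blockMulFst q Θ x.1, ofColL2 n x.2.1) ∈ rieszGraph 2 n ∧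
    (blockMulSnd p q Θ G x.1, x.2.2) ∈ rieszGraph q n}
  zero_mem' := by
    refine ⟨zero_mem _, zero_mem _, ?_, ?_⟩
    · simp only [Prod.fst_zero, Prod.snd_zero, map_zero]
      exact zero_mem _
    · simp only [Prod.fst_zero, Prod.snd_zero, map_zero]
      exact zero_mem _
  add_mem' := by
    rintro x y ⟨h1, h2, h3, h4⟩ ⟨k1, k2, k3, k4⟩
    refine ⟨add_mem h1 k1, add_mem h2 k2, ?_, ?_⟩
    · simpa using add_mem h3 k3
    · simpa using add_mem h4 k4
  smul_mem' := by
    rintro c x ⟨h1, h2, h3, h4⟩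
    refine ⟨Submodule.smul_mem _ c h1, Submodule.smul_mem _ c h2, ?_, ?_⟩
    · simpa using Submodule.smul_mem _ c h3
    · simpa using Submodule.smul_mem _ c h4

/-- The kernel of the Toeplitz operator with symbol `[Θ^*, 0; G, Θ]`. -/
def toeplitzKer : Submodule ℂ (ColL2 n × ColLp q n) :=
  (toeplitzGraph p q Θ G).comap (LinearMap.inl ℂ _ _)

/-- Evaluation at the origin, `(f₁, f₂) ↦ (f₁(0), f₂(0)) ∈ ℂ^n × ℂ^n = ℂ^{2n}`. -/
def pairAtZero (n : ℕ) : (ColL2 n × ColLp q n) →ₗ[ℂ] (Fin n → ℂ) × (Fin n → ℂ) :=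
  (colH2AtZero n).prodMap (colAtZero q n)

/-- The projection `P_n` onto the first `n` coordinates. -/
abbrev projFirst (n : ℕ) : (ColL2 n × ColLp q n) →ₗ[ℂ] ColL2 n := LinearMap.fst ℂ _ _

end Toeplitz

/-- `M` is a closed subspace of `(H^2)^n` that is nearly `S^*`-invariant with the finite
dimensional defect space `D ⊆ (H^2)^n`: every `f ∈ M` with `f(0) = 0` has `S^* f ∈ M + D`. -/
structure IsNearlyInvariant {n : ℕ} (M D : Submodule ℂ (ColL2 n)) : Prop where
  le_H2 : M ≤ colH2 n
  isClosed : IsClosed (M : Set (ColL2 n))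
  defect_le_H2 : D ≤ colH2 n
  finiteDimensional : FiniteDimensional ℂ D
  shift_mem : ∀ f ∈ M, colH2AtZero n f = 0 → backwardShift n f ∈ M ⊔ D

/-- The subspace `(span {P_n W_1, …, P_n W_r} / z) ∩ (H^2)^n`. -/
def defectSpace {n r : ℕ} (q : ℝ≥0∞) (W : Fin r → ColL2 n × ColLp q n) :
    Submodule ℂ (ColL2 n) :=
  (Submodule.span ℂ (Set.range fun i => projFirst q n (W i))).map (divZ n) ⊓ colH2 n

end MTTO

end

noncomputable section

open scoped ComplexConjugate

namespace MTTO

/-! ### Fourier coefficients and the spaces they cut out. -/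

section Coefficients

variable (q : ℝ≥0∞) [Fact (1 ≤ q)]

/-! A pair `F = (f₁, f₂)` of Hardy functions lies in the kernel iff `Θ* f₁` and `G f₁ + Θ f₂` are in
`conj (H_0)`. Division by `z` preserves the latter space, so the kernel is stable under division by
`z` of its elements vanishing at `0` (`divZ_mem_toeplitzKer`). If only `f₁(0) = 0`, subtract the `V`
in the span of the `W i` with `V(0) = F(0)`: then `(F - V)/z` is in the kernel, and the error `V₁/z`
lies in `D` (`backwardShift_mem_sup`).

Closedness of `M` is the analytic point. Since `Θ` is unitary, the second equation forces `f₂ = -Θ*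
P_{q+}(G f₁)`, so `M` is cut out by conditions on `f₁` alone (`isClosed_projFirst_toeplitzKer`).
They are closed because `P_{q+}` is bounded, which is the theorem of M. Riesz for `1 < q ≤ 2`,
proved here from a pointwise inequality in the right half plane and the mean value property.

For directness, let `V₁/z = F₁` with `V`, `F` in the kernel. Then `Θ (V₂ - z F₂)` is analytic and
co-analytic, hence a constant `c`, and evaluation at `0` gives `c = Θ(0) Θ(0)* c`. Purity yields `c
= 0`, so `V(0) = 0`, and independence of the `W i (0)` gives `V = 0`. The orthogonal defect space is
the projection of `D` onto the orthogonal complement of `M`. -/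

lemma coeff_apply (k : ℤ) (f : CircleLp q) :
    coeff q k f = fourierCoeff (f : UnitAddCircle → ℂ) k := rfl

lemma coeff_eq_integral (k : ℤ) (f : CircleLp q) :
    coeff q k f = ∫ x, fourier (-k) x * f x ∂arcLength := rfl

lemma coeff_congr {q r : ℝ≥0∞} [Fact (1 ≤ q)] [Fact (1 ≤ r)] {f : CircleLp q} {g : CircleLp r}
    (h : (f : UnitAddCircle → ℂ) =ᵐ[arcLength] g) (k : ℤ) : coeff q k f = coeff r k g :=
  congrFun (fourierCoeff_congr_ae h) k

lemma norm_coeff_le (k : ℤ) (f : CircleLp q) : ‖coeff q k f‖ ≤ ‖f‖ := by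
  rw [coeff_eq_integral]
  have hf : MemLp f 1 arcLength := (Lp.memLp f).mono_exponent Fact.out
  calc ‖∫ x, fourier (-k) x * f x ∂arcLength‖
      ≤ ∫ x, ‖fourier (-k) x * f x‖ ∂arcLength := norm_integral_le_integral_norm _
    _ = ∫ x, ‖f x‖ ∂arcLength := by
        refine integral_congr_ae (.of_forall fun x => ?_)
        simp only [norm_mul, fourier_apply, Circle.norm_coe, one_mul]
    _ = (eLpNorm f 1 arcLength).toReal := by
        rw [integral_norm_eq_lintegral_enorm hf.1, eLpNorm_one_eq_lintegral_enorm]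
    _ ≤ (eLpNorm f q arcLength).toReal :=
        ENNReal.toReal_mono (Lp.eLpNorm_ne_top f)
          (eLpNorm_le_eLpNorm_of_exponent_le Fact.out hf.1)
    _ = ‖f‖ := (Lp.norm_def f).symm

lemma continuous_coeff (k : ℤ) : Continuous (coeff q k) :=
  (LinearMap.mkContinuous (coeff q k) 1 fun f => by simpa using norm_coeff_le q k f).continuous

lemma mem_hardy_iff {f : CircleLp q} : f ∈ hardy q ↔ ∀ k < 0, coeff q k f = 0 := by
  simp [hardy, Submodule.mem_iInf]

lemma isClosed_hardy : IsClosed (hardy q : Set (CircleLp q)) := by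
  rw [hardy, Submodule.coe_iInf]
  exact isClosed_iInter fun k => isClosed_singleton.preimage (continuous_coeff q k)

lemma coeff_star (k : ℤ) (f : CircleLp q) : coeff q k (star f) = conj (coeff q (-k) f) := by
  rw [coeff_eq_integral, coeff_eq_integral, ← integral_conj]
  refine integral_congr_ae ?_
  filter_upwards [Lp.coeFn_star f] with x hx
  rw [hx, Pi.star_apply, map_mul, ← fourier_neg, neg_neg, starRingEnd_apply]

lemma mem_conjHardyZero_iff {g : CircleLp q} :
    g ∈ conjHardyZero q ↔ ∀ k, 0 ≤ k → coeff q k g = 0 := by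
  constructor
  · rintro ⟨f, hf, hf0, rfl⟩ k hk
    rw [coeff_star]
    rcases hk.eq_or_lt with rfl | hk
    · rw [neg_zero, hf0, map_zero]
    · rw [(mem_hardy_iff q).1 hf (-k) (by lia), map_zero]
  · intro h
    refine ⟨star g, (mem_hardy_iff q).2 fun k hk => ?_, ?_, (star_star g).symm⟩
    · rw [coeff_star, h (-k) (by lia), map_zero]
    · change coeff q 0 _ = 0
      rw [coeff_star, h _ (by simp), map_zero]

lemma isClosed_conjHardyZero : IsClosed (conjHardyZero q : Set (CircleLp q)) := by
  have : (conjHardyZero q : Set (CircleLp q)) = ⋂ k, ⋂ _ : 0 ≤ k, {g | coeff q k g = 0} := by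
    ext g
    simp [mem_conjHardyZero_iff]
  rw [this]
  exact isClosed_iInter fun k => isClosed_iInter fun _ =>
    isClosed_singleton.preimage (continuous_coeff q k)

lemma coeFn_mulLp {p s r : ℝ≥0∞} [ENNReal.HolderTriple p s r] (g : CircleLp p) (f : CircleLp s) :
    ((mulLp g f : CircleLp r) : UnitAddCircle → ℂ) =ᵐ[arcLength] fun x => g x * f x :=
  Lp.coeFn_lpSMul g f

lemma coeff_mulLp_fourier (m k : ℤ) (f : CircleLp q) :
    coeff q k (mulLp (fourierLp (T := 1) ∞ m) f : CircleLp q) = coeff q (k - m) f := by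
  rw [coeff_eq_integral, coeff_eq_integral]
  refine integral_congr_ae ?_
  filter_upwards [coeFn_mulLp (r := q) (fourierLp (T := 1) ∞ m) f, coeFn_fourierLp (T := 1) ∞ m]
    with x h1 h2
  rw [h1, h2, ← mul_assoc, ← fourier_add, show -(k - m) = -k + m by ring]

lemma coeff_fourierLp (m k : ℤ) : coeff q k (fourierLp (T := 1) q m) = if k = m then 1 else 0 := by
  rw [coeff_apply, fourierCoeff_congr_ae (coeFn_fourierLp q m), fourierCoeff_fourier]
  simp [Pi.single_apply]

lemma const_eq_smul_fourierLp (c : ℂ) :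
    Lp.const q arcLength c = c • fourierLp (T := 1) q 0 := by
  apply Lp.ext
  filter_upwards [Lp.coeFn_const q arcLength c, Lp.coeFn_smul c (fourierLp (T := 1) q 0),
    coeFn_fourierLp (T := 1) q 0] with x h1 h2 h3
  rw [h1, h2, Pi.smul_apply, h3]
  simp

lemma coeff_const (c : ℂ) (k : ℤ) :
    coeff q k (Lp.const q arcLength c) = if k = 0 then c else 0 := by
  rw [const_eq_smul_fourierLp, map_smul, coeff_fourierLp]
  simp

/-- A function in `L^q`, `1 < q`, is determined by its Fourier coefficients. -/
lemma eq_zero_of_coeff_eq_zero {q : ℝ≥0∞} [Fact (1 ≤ q)] (hq : 1 < q) {f : CircleLp q}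
    (h : ∀ k, coeff q k f = 0) : f = 0 := by
  let q' := ENNReal.conjExponent q
  have : ENNReal.HolderConjugate q q' := inferInstance
  have : Fact (1 ≤ q') := ⟨ENNReal.HolderConjugate.one_le q' q⟩
  -- This is where `1 < q` enters: the exponentials span a dense subspace of `L^{q'}` only for
  -- finite `q'`.
  have hq' : q' ≠ ∞ := fun h' => by
    have := (ENNReal.HolderConjugate.eq_top_iff_eq_one q' q).1 h'
    exact hq.ne' this
  let Φ : CircleLp q' →L[ℂ] ℂ := (ContinuousLinearMap.mul ℂ ℂ).lpPairing arcLength q q' f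
  have hΦ : ∀ g, Φ g = ∫ x, f x * g x ∂arcLength := fun g =>
    (ContinuousLinearMap.mul ℂ ℂ).lpPairing_eq_integral f g
  have hΦ0 : ∀ g, Φ g = 0 := by
    have hle : (Submodule.span ℂ (Set.range (@fourierLp 1 _ q' _))).topologicalClosure ≤
        LinearMap.ker Φ.toLinearMap := by
      refine Submodule.topologicalClosure_minimal _ (Submodule.span_le.2 ?_) Φ.isClosed_ker
      rintro _ ⟨k, rfl⟩
      change Φ _ = 0
      rw [hΦ, ← h (-k), coeff_eq_integral]
      refine integral_congr_ae ?_
      filter_upwards [coeFn_fourierLp (T := 1) q' k] with x hx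
      rw [hx, neg_neg, mul_comm]
    rw [span_fourierLp_closure_eq_top hq'] at hle
    exact fun g => hle (Submodule.mem_top : g ∈ ⊤)
  have hf : Integrable f arcLength := (Lp.memLp f).integrable Fact.out
  have : (f : UnitAddCircle → ℂ) =ᵐ[arcLength] 0 := by
    refine hf.ae_eq_zero_of_forall_setIntegral_eq_zero fun s hs _ => ?_
    have h1 := hΦ0 (indicatorConstLp q' hs (measure_ne_top _ s) (1 : ℂ))
    rw [hΦ] at h1
    rw [← h1, ← integral_indicator hs]
    refine integral_congr_ae ?_
    filter_upwards [indicatorConstLp_coeFn (p := q') (hs := hs) (hμs := measure_ne_top arcLength s)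
      (c := (1 : ℂ))] with x hx
    rw [hx]
    by_cases hxs : x ∈ s <;> simp [hxs]
  exact (Lp.eq_zero_iff_ae_eq_zero).2 this

lemma eq_of_coeff_eq {q : ℝ≥0∞} [Fact (1 ≤ q)] (hq : 1 < q) {f g : CircleLp q}
    (h : ∀ k, coeff q k f = coeff q k g) : f = g :=
  sub_eq_zero.1 (eq_zero_of_coeff_eq_zero hq fun k => by rw [map_sub, h, sub_self])

end Coefficients

/-! ### The analytic estimate behind the theorem of M. Riesz. -/

section Riesz

/-- Near `|θ| = π/2` the angle `θ q` has passed `π/2`, so `c cos (θ q) ≤ -1` for suitable `c`;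
elsewhere `cos θ` is bounded below and a large `C` suffices. The bound `q ≤ 2` keeps `|θ| q ≤ π`,
where the cosine still decreases. -/
lemma exists_one_add_mul_cos_le {q : ℝ} (hq : 1 < q) (hq2 : q ≤ 2) :
    ∃ C c : ℝ, 0 ≤ C ∧ 0 ≤ c ∧ ∀ θ : ℝ, |θ| < Real.pi / 2 →
      1 + c * Real.cos (θ * q) ≤ C * Real.cos θ ^ q := by
  have hπ := Real.pi_pos
  have hq0 : 0 < q := by linarith
  obtain ⟨φ, h1, h2⟩ : ∃ φ, Real.pi / 2 < φ * q ∧ φ < Real.pi / 2 := by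
    obtain ⟨φ, h1, h2⟩ := exists_between (show Real.pi / 2 / q < Real.pi / 2 by
      rw [div_lt_iff₀ hq0]; nlinarith)
    exact ⟨φ, (div_lt_iff₀ hq0).1 h1, h2⟩
  have hφ0 : 0 < φ := by
    by_contra! h
    nlinarith
  have h3 : φ * q ≤ Real.pi := by nlinarith
  have hcos : Real.cos (φ * q) < 0 := Real.cos_neg_of_pi_div_two_lt_of_lt h1 (by linarith)
  have hcosφ : 0 < Real.cos φ := Real.cos_pos_of_mem_Ioo ⟨by linarith, h2⟩
  have hc : 0 ≤ -(Real.cos (φ * q))⁻¹ := by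
    simpa using hcos.le
  have hpow : 0 < Real.cos φ ^ q := Real.rpow_pos_of_pos hcosφ q
  have hC : 0 ≤ (1 + -(Real.cos (φ * q))⁻¹) / Real.cos φ ^ q := by positivity
  -- Unification reads the witnesses off `hC` and `hc`: `c = -1 / cos (φ q)` and `C = (1 + c) / (cos
  -- φ)^q`.
  refine ⟨_, _, hC, hc, fun θ hθ => ?_⟩
  have hcosθ : 0 < Real.cos θ := Real.cos_pos_of_mem_Ioo (abs_lt.1 (by simpa using hθ))
  rcases le_total φ |θ| with h | h
  · have h4 : Real.cos (θ * q) ≤ Real.cos (φ * q) := by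
      rw [← Real.cos_abs (θ * q), abs_mul, abs_of_pos hq0]
      refine Real.cos_le_cos_of_nonneg_of_le_pi (by positivity) (by nlinarith) ?_
      gcongr
    have h5 : -(Real.cos (φ * q))⁻¹ * Real.cos (θ * q) ≤
        -(Real.cos (φ * q))⁻¹ * Real.cos (φ * q) := by gcongr
    have h6 : -(Real.cos (φ * q))⁻¹ * Real.cos (φ * q) = -1 := by
      rw [neg_mul, inv_mul_cancel₀ hcos.ne]
    have h7 := mul_nonneg hC (Real.rpow_nonneg hcosθ.le q)
    linarith
  · have h4 : Real.cos φ ≤ Real.cos θ := by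
      rw [← Real.cos_abs θ]
      exact Real.cos_le_cos_of_nonneg_of_le_pi (abs_nonneg θ) (by linarith) h
    have h5 : Real.cos φ ^ q ≤ Real.cos θ ^ q := Real.rpow_le_rpow hcosφ.le h4 hq0.le
    calc 1 + -(Real.cos (φ * q))⁻¹ * Real.cos (θ * q)
        ≤ 1 + -(Real.cos (φ * q))⁻¹ * 1 := by
          gcongr
          exact Real.cos_le_one _
      _ = (1 + -(Real.cos (φ * q))⁻¹) / Real.cos φ ^ q * Real.cos φ ^ q := by
          rw [div_mul_cancel₀ _ hpow.ne', mul_one]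
      _ ≤ _ := by gcongr

/-- The trigonometric inequality at `θ = arg w`, multiplied by `‖w‖ ^ q`. The term in `w ^ q` is the
real part of a holomorphic function, so its circle mean is its value at the centre. -/
lemma exists_norm_rpow_add_le {q : ℝ} (hq : 1 < q) (hq2 : q ≤ 2) :
    ∃ C c : ℝ, 0 ≤ C ∧ 0 ≤ c ∧ ∀ w : ℂ, 0 < w.re →
      ‖w‖ ^ q + c * (w ^ (q : ℂ)).re ≤ C * w.re ^ q := by
  obtain ⟨C, c, hC, hc, h⟩ := exists_one_add_mul_cos_le hq hq2
  refine ⟨C, c, hC, hc, fun w hw => ?_⟩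
  have harg : |w.arg| < Real.pi / 2 := Complex.abs_arg_lt_pi_div_two_iff.2 (Or.inl hw)
  have hw' : w.re = ‖w‖ * Real.cos w.arg := (Complex.norm_mul_cos_arg w).symm
  have hcos : 0 ≤ Real.cos w.arg := (Real.cos_pos_of_mem_Ioo (abs_lt.1 (by simpa using harg))).le
  have h1 := mul_le_mul_of_nonneg_left (h _ harg) (Real.rpow_nonneg (norm_nonneg w) q)
  rw [Complex.cpow_ofReal_re]
  conv_rhs => rw [hw', Real.mul_rpow (norm_nonneg w) hcos]
  linarith

lemma integral_arcLength_fourier_one (g : ℂ → ℂ) :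
    ∫ x, g (fourier 1 x) ∂arcLength = Real.circleAverage g 0 1 := by
  rw [AddCircle.integral_haarAddCircle, Real.circleAverage,
    ← UnitAddCircle.intervalIntegral_preimage 0]
  have h := intervalIntegral.smul_integral_comp_mul_left (a := 0) (b := 1)
    (fun θ => g (circleMap 0 1 θ)) (2 * Real.pi)
  rw [mul_zero, mul_one] at h
  rw [← h, smul_smul, inv_mul_cancel₀ (by positivity), inv_one, zero_add]
  congr 1
  refine intervalIntegral.integral_congr fun x _ => ?_
  simp only [fourier_coe_apply, circleMap]
  congr 1
  push_cast
  simp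
  ring_nf

/-- Maximum principle for `exp (-F)`, whose modulus is `exp (-Re F)`. -/
lemma re_pos_of_re_pos_on_circle {F : ℂ → ℂ} (hF : Differentiable ℂ F) {ε : ℝ} (hε : 0 < ε)
    (h : ∀ z, ‖z‖ = 1 → ε ≤ (F z).re) {z : ℂ} (hz : ‖z‖ ≤ 1) : 0 < (F z).re := by
  have h1 : ‖Complex.exp (-F z)‖ ≤ Real.exp (-ε) := by
    refine Complex.norm_le_of_forall_mem_frontier_norm_le (U := Metric.ball 0 1)
      Metric.isBounded_ball (f := fun z => Complex.exp (-F z)) hF.neg.cexp.diffContOnCl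
      (fun w hw => ?_) ?_
    · rw [frontier_ball _ one_ne_zero, mem_sphere_zero_iff_norm] at hw
      rw [Complex.norm_exp, Complex.neg_re]
      exact Real.exp_le_exp.2 (neg_le_neg (h w hw))
    · rw [closure_ball _ one_ne_zero]
      simpa using hz
  rw [Complex.norm_exp, Complex.neg_re, Real.exp_le_exp] at h1
  linarith

/-- The classical estimate behind the theorem of M. Riesz: the `L^q` norm of an analytic function
with positive real part, real at the origin, is controlled by that of its real part. -/
lemma integral_norm_rpow_le {q C c : ℝ} (hc : 0 ≤ c)
    (hCc : ∀ w : ℂ, 0 < w.re → ‖w‖ ^ q + c * (w ^ (q : ℂ)).re ≤ C * w.re ^ q)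
    (hq : 0 ≤ q) {F : ℂ → ℂ} (hF : Differentiable ℂ F) {ε : ℝ} (hε : 0 < ε)
    (h : ∀ z, ‖z‖ = 1 → ε ≤ (F z).re) (h0 : (F 0).im = 0) :
    ∫ x, ‖F (fourier 1 x)‖ ^ q ∂arcLength ≤ C * ∫ x, (F (fourier 1 x)).re ^ q ∂arcLength := by
  have hpos : ∀ z, ‖z‖ ≤ 1 → 0 < (F z).re := fun z hz => re_pos_of_re_pos_on_circle hF hε h hz
  have hnorm : ∀ x : UnitAddCircle, ‖(fourier 1 x : ℂ)‖ = 1 := fun x => by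
    rw [fourier_apply, Circle.norm_coe]
  have hcontF : Continuous fun x : UnitAddCircle => F (fourier 1 x) :=
    hF.continuous.comp (map_continuous _)
  -- The positive real part keeps `F` off the branch cut of the power.
  have hd : DiffContOnCl ℂ (fun z => F z ^ (q : ℂ)) (Metric.ball 0 |1|) := by
    refine DifferentiableOn.diffContOnCl fun z hz => ?_
    have hz' : ‖z‖ ≤ 1 := by
      rw [closure_ball _ (by simp)] at hz
      simpa using hz
    exact ((hF z).cpow_const (Or.inl (hpos z hz'))).differentiableWithinAt
  have hmean : ∫ x : UnitAddCircle, F (fourier 1 x) ^ (q : ℂ) ∂arcLength = F 0 ^ (q : ℂ) := by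
    rw [integral_arcLength_fourier_one fun z => F z ^ (q : ℂ)]
    exact hd.circleAverage
  have hcontpow : Continuous fun x : UnitAddCircle => F (fourier 1 x) ^ (q : ℂ) :=
    hcontF.cpow continuous_const fun x => Or.inl (hpos _ (hnorm x).le)
  have hint : ∀ {E : Type} [NormedAddCommGroup E] {g : UnitAddCircle → E}, Continuous g →
      Integrable g arcLength := fun hg =>
    hg.integrable_of_hasCompactSupport (HasCompactSupport.of_compactSpace _)
  have hint1 : Integrable (fun x : UnitAddCircle => ‖F (fourier 1 x)‖ ^ q) arcLength :=
    hint (hcontF.norm.rpow_const fun _ => Or.inr hq)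
  have hint2 : Integrable (fun x : UnitAddCircle => (F (fourier 1 x)).re ^ q) arcLength :=
    hint ((Complex.continuous_re.comp hcontF).rpow_const fun _ => Or.inr hq)
  have hint3 : Integrable (fun x : UnitAddCircle => c * (F (fourier 1 x) ^ (q : ℂ)).re)
      arcLength := hint (continuous_const.mul (Complex.continuous_re.comp hcontpow))
  have hre : ∫ x : UnitAddCircle, (F (fourier 1 x) ^ (q : ℂ)).re ∂arcLength =
      (F 0 ^ (q : ℂ)).re := by
    rw [← hmean]
    exact integral_re (𝕜 := ℂ) (hint hcontpow)
  -- `F 0` is a positive real number, so the mean of the extra term is nonnegative and can be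
  -- dropped.
  have h0' : 0 ≤ (F 0 ^ (q : ℂ)).re := by
    have hF0 : F 0 = ((F 0).re : ℂ) := Complex.ext (by simp) (by simp [h0])
    rw [hF0, ← Complex.ofReal_cpow (hpos 0 (by simp)).le, Complex.ofReal_re]
    exact Real.rpow_nonneg (hpos 0 (by simp)).le q
  have key := integral_mono (hint1.add hint3) (hint2.const_mul C)
    fun x => hCc _ (hpos _ (hnorm x).le)
  simp only [Pi.add_apply] at key
  rw [integral_add hint1 hint3, integral_const_mul, integral_const_mul, hre] at key
  nlinarith [mul_nonneg hc h0']

end Riesz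

/-! ### Boundedness of the Riesz projection on `L^q`. -/

section RieszProjection

/-- The class in `L^q` of a continuous function on the circle. -/
abbrev ofCont (q : ℝ≥0∞) [Fact (1 ≤ q)] : C(UnitAddCircle, ℂ) →L[ℂ] CircleLp q :=
  ContinuousMap.toLp q arcLength ℂ

/-- A real continuous function on the circle, regarded as a complex one. -/
def realCont (v : C(UnitAddCircle, ℝ)) : C(UnitAddCircle, ℂ) := ⟨fun x => v x, by fun_prop⟩

@[simp] lemma realCont_apply (v : C(UnitAddCircle, ℝ)) (x : UnitAddCircle) :
    realCont v x = v x := rfl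

/-- A polynomial, restricted to the circle. -/
def polyCircle (P : Polynomial ℂ) : C(UnitAddCircle, ℂ) := Polynomial.aeval (fourier 1) P

lemma polyCircle_apply (P : Polynomial ℂ) (x : UnitAddCircle) :
    polyCircle P x = P.eval (fourier 1 x) := by
  rw [polyCircle, Polynomial.aeval_continuousMap_apply]

lemma fourierCoeff_polyCircle (P : Polynomial ℂ) (k : ℤ) :
    fourierCoeff (polyCircle P) k = if 0 ≤ k then P.coeff k.natAbs else 0 := by
  have hint : ∀ f : C(UnitAddCircle, ℂ), Integrable f arcLength := fun f =>
    f.continuous.integrable_of_hasCompactSupport (HasCompactSupport.of_compactSpace _)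
  induction P using Polynomial.induction_on' with
  | add P Q hP hQ =>
    have : (polyCircle (P + Q) : UnitAddCircle → ℂ) = polyCircle P + polyCircle Q := by
      ext x
      simp [polyCircle]
    rw [this, fourierCoeff.add (hint _) (hint _), Pi.add_apply, hP, hQ, Polynomial.coeff_add]
    split_ifs <;> simp
  | monomial m a =>
    have : (polyCircle (Polynomial.monomial m a) : UnitAddCircle → ℂ) =
        a • (fourier (m : ℤ) : UnitAddCircle → ℂ) := by
      ext x
      simp [polyCircle_apply, fourier_apply, AddCircle.toCircle_nsmul]
    rw [this, fourierCoeff.const_smul, fourierCoeff_fourier, Polynomial.coeff_monomial]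
    simp only [Pi.single_apply, smul_eq_mul, mul_ite, mul_one, mul_zero]
    grind

lemma coeff_ofCont (q : ℝ≥0∞) [Fact (1 ≤ q)] (f : C(UnitAddCircle, ℂ)) (k : ℤ) :
    coeff q k (ofCont q f) = fourierCoeff f k :=
  congrFun (fourierCoeff_congr_ae (ContinuousMap.coeFn_toLp arcLength f)) k

lemma norm_ofCont_rpow {q : ℝ≥0∞} [Fact (1 ≤ q)] (hq : q ≠ ∞) (f : C(UnitAddCircle, ℂ)) :
    ‖ofCont q f‖ ^ q.toReal = ∫ x, ‖f x‖ ^ q.toReal ∂arcLength := by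
  have hq0 : q ≠ 0 := (one_pos.trans_le Fact.out).ne'
  have hqr : 0 < q.toReal := ENNReal.toReal_pos hq0 hq
  have hnn : 0 ≤ ∫ x, ‖f x‖ ^ q.toReal ∂arcLength := integral_nonneg fun x => by positivity
  have hf : MemLp f q arcLength :=
    (memLp_congr_ae (ContinuousMap.coeFn_toLp arcLength f)).1 (Lp.memLp (ofCont q f))
  rw [Lp.norm_def, eLpNorm_congr_ae (ContinuousMap.coeFn_toLp arcLength f),
    hf.eLpNorm_eq_integral_rpow_norm hq0 hq, ENNReal.toReal_ofReal (by positivity),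
    ← Real.rpow_mul hnn, inv_mul_cancel₀ hqr.ne', Real.rpow_one]

lemma norm_ofCont_le_of_norm_le {q : ℝ≥0∞} [Fact (1 ≤ q)] {f g : C(UnitAddCircle, ℂ)}
    (h : ∀ x, ‖f x‖ ≤ ‖g x‖) : ‖ofCont q f‖ ≤ ‖ofCont q g‖ := by
  refine Lp.norm_le_norm_of_ae_le ?_
  filter_upwards [ContinuousMap.coeFn_toLp (p := q) (𝕜 := ℂ) arcLength f,
    ContinuousMap.coeFn_toLp (p := q) (𝕜 := ℂ) arcLength g] with x h1 h2
  rw [h1, h2]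
  exact h x

lemma norm_ofCont_le {q : ℝ≥0∞} [Fact (1 ≤ q)] {f : C(UnitAddCircle, ℂ)} {c : ℝ} (hc : 0 ≤ c)
    (h : ∀ x, ‖f x‖ ≤ c) : ‖ofCont q f‖ ≤ c := by
  have h1 : ∀ᵐ x ∂arcLength, ‖(ofCont q f : UnitAddCircle → ℂ) x‖ ≤ c := by
    filter_upwards [ContinuousMap.coeFn_toLp (p := q) (𝕜 := ℂ) arcLength f] with x h1
    rw [h1]
    exact h x
  simpa [measureUnivNNReal] using Lp.norm_le_of_ae_bound hc h1

/-- Real parts of polynomials are dense in the real continuous functions on the circle. -/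
lemma exists_polyCircle_re_near (v : C(UnitAddCircle, ℝ)) {ε : ℝ} (hε : 0 < ε) :
    ∃ P : Polynomial ℂ, (P.coeff 0).im = 0 ∧ ∀ x, |(polyCircle P x).re - v x| ≤ ε := by
  have h1 : realCont v ∈ closure
      (Submodule.span ℂ (Set.range (@fourier 1)) : Set C(UnitAddCircle, ℂ)) := by
    rw [← Submodule.topologicalClosure_coe, span_fourier_closure_eq_top]
    trivial
  obtain ⟨t, ht, htv⟩ := Metric.mem_closure_iff.1 h1 ε hε
  -- A trigonometric polynomial splits into its nonnegative and nonpositive frequencies.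
  obtain ⟨P, Q, hPQ⟩ : ∃ P Q : Polynomial ℂ, ∀ x, t x = polyCircle P x + conj (polyCircle Q x) := by
    clear htv
    induction ht using Submodule.span_induction with
    | mem t ht =>
      obtain ⟨k, rfl⟩ := ht
      rcases le_total 0 k with hk | hk
      · obtain ⟨m, rfl⟩ := Int.eq_ofNat_of_zero_le hk
        exact ⟨Polynomial.X ^ m, 0, fun x => by
          simp [polyCircle_apply, fourier_apply, AddCircle.toCircle_nsmul]⟩
      · obtain ⟨m, hm⟩ := Int.eq_ofNat_of_zero_le (neg_nonneg.2 hk)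
        refine ⟨0, Polynomial.X ^ m, fun x => ?_⟩
        rw [show k = -(m : ℤ) by lia, fourier_neg]
        simp [polyCircle_apply, fourier_apply, AddCircle.toCircle_nsmul]
    | zero => exact ⟨0, 0, fun x => by simp [polyCircle]⟩
    | add s t _ _ hs ht =>
      obtain ⟨P, Q, h⟩ := hs
      obtain ⟨P', Q', h'⟩ := ht
      refine ⟨P + P', Q + Q', fun x => ?_⟩
      simp only [ContinuousMap.add_apply, h, h', polyCircle, map_add]
      ring
    | smul c t _ ht =>
      obtain ⟨P, Q, h⟩ := ht
      refine ⟨c • P, conj c • Q, fun x => ?_⟩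
      simp [h, polyCircle, mul_add]
  -- `P + conj Q` and `P + Q` have the same real part, and subtracting an imaginary constant does
  -- not change it.
  refine ⟨P + Q - Polynomial.C (((P + Q).coeff 0).im * Complex.I), by simp, fun x => ?_⟩
  have h2 : ‖realCont v x - t x‖ ≤ ε := (dist_eq_norm (realCont v) t ▸
    (realCont v - t).norm_coe_le_norm x).trans htv.le
  have h3 := (Complex.abs_re_le_norm _).trans h2
  rw [abs_sub_comm]
  convert! h3 using 2
  simp [hPQ, polyCircle_apply]

instance : CompleteSpace (hardy 2) := (isClosed_hardy 2).completeSpace_coe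

/-- The Riesz projection on `L^2`. -/
def rieszL2 : CircleLp 2 →L[ℂ] CircleLp 2 := (hardy 2).starProjection

lemma coeff_two_eq_inner (k : ℤ) (f : CircleLp 2) :
    coeff 2 k f = inner ℂ (fourierLp (T := 1) 2 k) f := by
  rw [coeff_apply, ← fourierBasis_repr, fourierBasis.repr_apply_apply, coe_fourierBasis]

lemma coeff_rieszL2 (f : CircleLp 2) (k : ℤ) :
    coeff 2 k (rieszL2 f) = if 0 ≤ k then coeff 2 k f else 0 := by
  split_ifs with hk
  · have hmem : fourierLp (T := 1) 2 k ∈ hardy 2 := (mem_hardy_iff 2).2 fun j hj => by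
      rw [coeff_fourierLp, if_neg (by lia)]
    rw [coeff_two_eq_inner, coeff_two_eq_inner, rieszL2,
      ← Submodule.inner_starProjection_left_eq_right,
      Submodule.starProjection_eq_self_iff.2 hmem]
  · exact (mem_hardy_iff 2).1 (Submodule.starProjection_apply_mem _ f) k (not_le.1 hk)

lemma norm_rieszL2_le (f : CircleLp 2) : ‖rieszL2 f‖ ≤ ‖f‖ :=
  Submodule.norm_starProjection_apply_le _ f

/-- The inclusion `L^2 → L^q`, `q ≤ 2`. -/
def inclL2 (q : ℝ≥0∞) [Fact (1 ≤ q)] (hq : q ≤ 2) : CircleLp 2 →L[ℂ] CircleLp q :=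
  LinearMap.mkContinuous
    { toFun := fun f => ((Lp.memLp f).mono_exponent hq).toLp f
      map_add' := fun f g => by
        rw [← MemLp.toLp_add]
        exact MemLp.toLp_congr _ _ (Lp.coeFn_add f g)
      map_smul' := fun c f => by
        rw [RingHom.id_apply, ← MemLp.toLp_const_smul]
        exact MemLp.toLp_congr _ _ (Lp.coeFn_smul c f) } 1 fun f => by
    rw [one_mul, LinearMap.coe_mk, AddHom.coe_mk, Lp.norm_toLp, Lp.norm_def]
    exact ENNReal.toReal_mono (Lp.eLpNorm_ne_top f)
      (eLpNorm_le_eLpNorm_of_exponent_le hq (Lp.aestronglyMeasurable f))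

lemma coeFn_inclL2 (q : ℝ≥0∞) [Fact (1 ≤ q)] (hq : q ≤ 2) (f : CircleLp 2) :
    (inclL2 q hq f : UnitAddCircle → ℂ) =ᵐ[arcLength] f :=
  MemLp.coeFn_toLp ((Lp.memLp f).mono_exponent hq)

lemma norm_inclL2_le (q : ℝ≥0∞) [Fact (1 ≤ q)] (hq : q ≤ 2) (f : CircleLp 2) :
    ‖inclL2 q hq f‖ ≤ ‖f‖ := by
  rw [Lp.norm_def, Lp.norm_def, eLpNorm_congr_ae (coeFn_inclL2 q hq f)]
  exact ENNReal.toReal_mono (Lp.eLpNorm_ne_top f)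
    (eLpNorm_le_eLpNorm_of_exponent_le hq (Lp.aestronglyMeasurable f))

lemma inclL2_ofCont (q : ℝ≥0∞) [Fact (1 ≤ q)] (hq : q ≤ 2) (f : C(UnitAddCircle, ℂ)) :
    inclL2 q hq (ofCont 2 f) = ofCont q f := by
  apply Lp.ext
  filter_upwards [coeFn_inclL2 q hq (ofCont 2 f),
    ContinuousMap.coeFn_toLp (p := 2) (𝕜 := ℂ) arcLength f,
    ContinuousMap.coeFn_toLp (p := q) (𝕜 := ℂ) arcLength f] with x h1 h2 h3
  rw [h1, h2, h3]

/-- The real part of a polynomial on the circle. -/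
def polyRe (P : Polynomial ℂ) : C(UnitAddCircle, ℝ) :=
  ⟨fun x => (polyCircle P x).re, by fun_prop⟩

/-- Write `Re P = (P + conj P) / 2`; the projection keeps `P` and, of `conj P`, only the constant
term, which equals `P(0)` as this is real. -/
lemma rieszL2_polyRe {P : Polynomial ℂ} (hP : (P.coeff 0).im = 0) :
    rieszL2 (ofCont 2 (realCont (polyRe P))) =
      (1 / 2 : ℂ) • ofCont 2 (polyCircle P) + (1 / 2 * P.coeff 0) • ofCont 2 (fourier 0) := by
  refine eq_of_coeff_eq (by norm_num) fun k => ?_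
  have h1 : ofCont 2 (realCont (polyRe P)) =
      (1 / 2 : ℂ) • ofCont 2 (polyCircle P) + (1 / 2 : ℂ) • star (ofCont 2 (polyCircle P)) := by
    apply Lp.ext
    filter_upwards [ContinuousMap.coeFn_toLp (p := 2) (𝕜 := ℂ) arcLength (realCont (polyRe P)),
      Lp.coeFn_add ((1 / 2 : ℂ) • ofCont 2 (polyCircle P))
        ((1 / 2 : ℂ) • star (ofCont 2 (polyCircle P))),
      Lp.coeFn_smul (1 / 2 : ℂ) (ofCont 2 (polyCircle P)),
      Lp.coeFn_smul (1 / 2 : ℂ) (star (ofCont 2 (polyCircle P))),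
      Lp.coeFn_star (ofCont 2 (polyCircle P)),
      ContinuousMap.coeFn_toLp (p := 2) (𝕜 := ℂ) arcLength (polyCircle P)] with x h1 h2 h3 h4 h5 h6
    rw [h1, h2, Pi.add_apply, h3, h4, Pi.smul_apply, Pi.smul_apply, h5, Pi.star_apply, h6,
      realCont_apply, ← starRingEnd_apply, ← smul_add, Complex.add_conj]
    simp [polyRe]
  have h2 : conj (P.coeff 0) = P.coeff 0 := Complex.conj_eq_iff_im.2 hP
  rw [coeff_rieszL2, h1]
  simp only [map_add, map_smul, coeff_star, coeff_ofCont, fourierCoeff_polyCircle,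
    fourierCoeff_fourier, Pi.single_apply, smul_eq_mul]
  rcases lt_trichotomy k 0 with hk | rfl | hk
  · rw [if_neg (by lia), if_neg (by lia), if_neg (by lia)]
    simp
  · simp [h2]
  · simp [hk.le, hk.ne', hk.not_ge]

/-- The theorem of M. Riesz for nonnegative continuous functions. -/
lemma exists_norm_rieszL2_le_of_nonneg {q : ℝ≥0∞} [Fact (1 ≤ q)] (hq : 1 < q) (hq2 : q ≤ 2) :
    ∃ C : ℝ, 0 ≤ C ∧ ∀ v : C(UnitAddCircle, ℝ), (∀ x, 0 ≤ v x) →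
      ‖inclL2 q hq2 (rieszL2 (ofCont 2 (realCont v)))‖ ≤ C * ‖ofCont q (realCont v)‖ := by
  have hqt : q ≠ ∞ := (hq2.trans_lt (by norm_num)).ne
  have hq1' : 1 < q.toReal := by
    rw [← ENNReal.toReal_one]
    exact (ENNReal.toReal_lt_toReal (by norm_num) hqt).2 hq
  have hq2' : q.toReal ≤ 2 := by
    rw [← ENNReal.toReal_ofNat]
    exact (ENNReal.toReal_le_toReal hqt (by norm_num)).2 hq2
  obtain ⟨C, c, hC, hc, hCc⟩ := exists_norm_rpow_add_le hq1' hq2'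
  -- The estimate holds for `q`-th powers of norms, hence the `q`-th root.
  set K : ℝ := C ^ (q.toReal)⁻¹ with hK
  have hK0 : 0 ≤ K := Real.rpow_nonneg hC _
  have hpoly : ∀ P : Polynomial ℂ, (P.coeff 0).im = 0 → ∀ ε : ℝ, 0 < ε →
      (∀ x, ε ≤ (polyCircle P x).re) →
      ‖ofCont q (polyCircle P)‖ ≤ K * ‖ofCont q (realCont (polyRe P))‖ := by
    intro P hP ε hε h
    have key := integral_norm_rpow_le hc hCc (by linarith) (F := fun z => P.eval z)
      P.differentiable hε (fun z hz => ?_) (by rwa [← Polynomial.coeff_zero_eq_eval_zero])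
    · rw [← Real.rpow_le_rpow_iff (norm_nonneg _) (by positivity) (by linarith : 0 < q.toReal),
        Real.mul_rpow hK0 (norm_nonneg _), norm_ofCont_rpow hqt, norm_ofCont_rpow hqt, hK,
        ← Real.rpow_mul hC, inv_mul_cancel₀ (by linarith), Real.rpow_one]
      simp only [polyCircle_apply]
      refine key.trans_eq ?_
      congr 1
      refine integral_congr_ae (.of_forall fun x => ?_)
      have := hε.trans_le (h x)
      simp [polyRe, polyCircle_apply] at this ⊢
      rw [abs_of_pos this]
    · obtain ⟨x, hx⟩ := (AddCircle.homeomorphCircle (T := 1) one_ne_zero).surjective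
        ⟨z, mem_sphere_zero_iff_norm.2 hz⟩
      have hx' : fourier 1 x = z := by
        rw [fourier_one, ← AddCircle.homeomorphCircle_apply one_ne_zero, hx]
      rw [← hx', ← polyCircle_apply]
      exact h x
  refine ⟨K, hK0, fun v hv => le_of_forall_pos_le_add fun δ hδ => ?_⟩
  -- Replacing `v` by `Re P` costs `3 ε` on the left and `K * 3 ε` on the right, in total `δ`.
  set ε := δ / (3 * K + 3) with hεdef
  have hε : 0 < ε := by positivity
  -- The shift by `2 ε` makes the `ε`-approximation satisfy `Re P ≥ ε`, while staying within `3 ε`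
  -- of `v`.
  obtain ⟨P, hP, hPv⟩ := exists_polyCircle_re_near (v + ContinuousMap.const _ (2 * ε)) hε
  have hPv' : ∀ x, |(polyCircle P x).re - (v x + 2 * ε)| ≤ ε := hPv
  have hclose : ∀ r : ℝ≥0∞, ∀ [Fact (1 ≤ r)],
      ‖ofCont r (realCont v) - ofCont r (realCont (polyRe P))‖ ≤ 3 * ε := by
    intro r _
    rw [← map_sub]
    refine norm_ofCont_le (by positivity) fun x => ?_
    have := abs_le.1 (hPv' x)
    rw [ContinuousMap.sub_apply, realCont_apply, realCont_apply, ← Complex.ofReal_sub,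
      Complex.norm_real, Real.norm_eq_abs, abs_le]
    simp only [polyRe, ContinuousMap.coe_mk]
    constructor <;> linarith
  have h1 := hpoly P hP ε hε fun x => by
    have := abs_le.1 (hPv' x)
    have := hv x
    linarith
  have h0 : ‖P.coeff 0‖ ≤ ‖ofCont q (polyCircle P)‖ := by
    have := norm_coeff_le q 0 (ofCont q (polyCircle P))
    rwa [coeff_ofCont, fourierCoeff_polyCircle, if_pos le_rfl] at this
  have hone : ‖ofCont q (fourier 0)‖ ≤ 1 := norm_ofCont_le zero_le_one fun x => by simp
  -- The projection of `Re P` is `(P + P(0)) / 2`, and `|P(0)| ≤ ‖P‖`.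
  have h2 : ‖inclL2 q hq2 (rieszL2 (ofCont 2 (realCont (polyRe P))))‖ ≤
      ‖ofCont q (polyCircle P)‖ := by
    rw [rieszL2_polyRe hP, map_add, map_smul, map_smul, inclL2_ofCont, inclL2_ofCont]
    refine (norm_add_le _ _).trans ?_
    rw [norm_smul, norm_smul, norm_mul]
    norm_num
    nlinarith [norm_nonneg (P.coeff 0), norm_nonneg (ofCont q (polyCircle P))]
  have h3 : ‖inclL2 q hq2 (rieszL2 (ofCont 2 (realCont v))) -
      inclL2 q hq2 (rieszL2 (ofCont 2 (realCont (polyRe P))))‖ ≤ 3 * ε := by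
    rw [← map_sub, ← map_sub]
    exact ((norm_inclL2_le q hq2 _).trans (norm_rieszL2_le _)).trans (hclose 2)
  have h4 : ‖ofCont q (realCont (polyRe P))‖ ≤ ‖ofCont q (realCont v)‖ + 3 * ε := by
    have := norm_le_norm_add_norm_sub' (ofCont q (realCont (polyRe P))) (ofCont q (realCont v))
    rw [norm_sub_rev] at this
    linarith [hclose q]
  have h5 := norm_le_norm_add_norm_sub' (inclL2 q hq2 (rieszL2 (ofCont 2 (realCont v))))
    (inclL2 q hq2 (rieszL2 (ofCont 2 (realCont (polyRe P)))))
  have h6 : (3 * K + 3) * ε = δ := mul_div_cancel₀ _ (by positivity)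
  have h7 := mul_le_mul_of_nonneg_left h4 hK0
  linarith

/-- The theorem of M. Riesz for continuous functions. -/
lemma exists_norm_rieszL2_le {q : ℝ≥0∞} [Fact (1 ≤ q)] (hq : 1 < q) (hq2 : q ≤ 2) :
    ∃ C : ℝ, ∀ f : C(UnitAddCircle, ℂ),
      ‖inclL2 q hq2 (rieszL2 (ofCont 2 f))‖ ≤ C * ‖ofCont q f‖ := by
  obtain ⟨C, hC, h⟩ := exists_norm_rieszL2_le_of_nonneg hq hq2
  refine ⟨C + C + (C + C), fun f => ?_⟩
  -- Positive and negative parts of `Re f` and `Im f`, each dominated by `|f|`; each contributes one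
  -- `C`.
  let v₁ : C(UnitAddCircle, ℝ) := ⟨fun x => max (f x).re 0, by fun_prop⟩
  let v₂ : C(UnitAddCircle, ℝ) := ⟨fun x => max (-(f x).re) 0, by fun_prop⟩
  let v₃ : C(UnitAddCircle, ℝ) := ⟨fun x => max (f x).im 0, by fun_prop⟩
  let v₄ : C(UnitAddCircle, ℝ) := ⟨fun x => max (-(f x).im) 0, by fun_prop⟩
  have hf : f = realCont v₁ - realCont v₂ +
      Complex.I • (realCont v₃ - realCont v₄) := by
    ext x
    apply Complex.ext <;> simp [v₁, v₂, v₃, v₄]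
  have key : ∀ v : C(UnitAddCircle, ℝ), (∀ x, 0 ≤ v x) → (∀ x, v x ≤ ‖f x‖) →
      ‖inclL2 q hq2 (rieszL2 (ofCont 2 (realCont v)))‖ ≤ C * ‖ofCont q f‖ := by
    intro v hv hvf
    refine (h v hv).trans (mul_le_mul_of_nonneg_left (norm_ofCont_le_of_norm_le fun x => ?_) hC)
    rw [realCont_apply, Complex.norm_real, Real.norm_of_nonneg (hv x)]
    exact hvf x
  have hre := fun x => abs_le.1 (Complex.abs_re_le_norm (f x))
  have him := fun x => abs_le.1 (Complex.abs_im_le_norm (f x))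
  have k₁ := key v₁ (fun x => le_max_right _ _) fun x => max_le (hre x).2 (norm_nonneg _)
  have k₂ := key v₂ (fun x => le_max_right _ _) fun x =>
    max_le (by linarith [(hre x).1]) (norm_nonneg _)
  have k₃ := key v₃ (fun x => le_max_right _ _) fun x => max_le (him x).2 (norm_nonneg _)
  have k₄ := key v₄ (fun x => le_max_right _ _) fun x =>
    max_le (by linarith [(him x).1]) (norm_nonneg _)
  conv_lhs => rw [hf]
  simp only [map_add, map_sub, map_smul]
  refine (norm_add_le _ _).trans ?_
  rw [norm_smul, Complex.norm_I, one_mul]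
  refine (add_le_add (norm_sub_le _ _) (norm_sub_le _ _)).trans ?_
  linarith

/-- The Riesz projection on `L^q`, `1 < q ≤ 2`. -/
lemma exists_riesz {q : ℝ≥0∞} [Fact (1 ≤ q)] (hq : 1 < q) (hq2 : q ≤ 2) :
    ∃ R : CircleLp q →L[ℂ] CircleLp q,
      (∀ f k, coeff q k (R f) = if 0 ≤ k then coeff q k f else 0) ∧
      ∀ f : C(UnitAddCircle, ℂ), R (ofCont q f) = inclL2 q hq2 (rieszL2 (ofCont 2 f)) := by
  have hqt : q ≠ ∞ := (hq2.trans_lt (by norm_num)).ne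
  have hd : DenseRange (ofCont q).toLinearMap := ContinuousMap.toLp_denseRange ℂ arcLength ℂ hqt
  let T : C(UnitAddCircle, ℂ) →ₗ[ℂ] CircleLp q :=
    (inclL2 q hq2 ∘L rieszL2 ∘L ofCont 2).toLinearMap
  have hR : ∀ f : C(UnitAddCircle, ℂ), T.extendOfNorm (ofCont q).toLinearMap (ofCont q f) =
      inclL2 q hq2 (rieszL2 (ofCont 2 f)) :=
    LinearMap.extendOfNorm_eq hd (exists_norm_rieszL2_le hq hq2)
  refine ⟨T.extendOfNorm (ofCont q).toLinearMap, fun f k => ?_, hR⟩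
  have hcoeff : Continuous (coeff q k) := continuous_coeff q k
  -- The coefficient identity is a closed condition, so it need only be checked on continuous
  -- functions, where it holds in `L^2`.
  have hcl : IsClosed {f : CircleLp q | coeff q k (T.extendOfNorm (ofCont q).toLinearMap f) =
      if 0 ≤ k then coeff q k f else 0} := by
    refine isClosed_eq (hcoeff.comp (ContinuousLinearMap.continuous _)) ?_
    split_ifs
    · exact hcoeff
    · exact continuous_const
  refine hd.induction_on (p := fun f => coeff q k (T.extendOfNorm (ofCont q).toLinearMap f) =
      if 0 ≤ k then coeff q k f else 0) f hcl fun g => ?_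
  change coeff q k (T.extendOfNorm (ofCont q).toLinearMap (ofCont q g)) =
    if 0 ≤ k then coeff q k (ofCont q g) else 0
  rw [hR, coeff_congr (coeFn_inclL2 q hq2 _), coeff_rieszL2, coeff_ofCont, coeff_ofCont]

end RieszProjection

/-! ### Products of `H^∞` and `H^q` functions. -/

section Products

/-- Multiplication by a fixed function, as a continuous linear map. -/
def mulLpL {p s q : ℝ≥0∞} [ENNReal.HolderTriple p s q] [Fact (1 ≤ s)] [Fact (1 ≤ q)]
    (g : CircleLp p) : CircleLp s →L[ℂ] CircleLp q :=
  LinearMap.mkContinuous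
    { toFun := fun f => mulLp g f
      map_add' := mulLp_add g
      map_smul' := mulLp_smul g } ‖g‖ fun f => Lp.norm_smul_le g f

@[simp] lemma mulLpL_apply {p s q : ℝ≥0∞} [ENNReal.HolderTriple p s q] [Fact (1 ≤ s)]
    [Fact (1 ≤ q)] (g : CircleLp p) (f : CircleLp s) :
    (mulLpL g f : CircleLp q) = mulLp g f := rfl

lemma mulLp_mulLp_comm {p s q : ℝ≥0∞} [ENNReal.HolderTriple p s q] (g : CircleLp p)
    (e : CircleLp ∞) (f : CircleLp s) :
    (mulLp g (mulLp e f : CircleLp s) : CircleLp q) = mulLp e (mulLp g f : CircleLp q) := by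
  apply Lp.ext
  filter_upwards [coeFn_mulLp (r := q) g (mulLp e f : CircleLp s), coeFn_mulLp (r := s) e f,
    coeFn_mulLp (r := q) e (mulLp g f : CircleLp q), coeFn_mulLp (r := q) g f] with x h1 h2 h3 h4
  rw [h1, h2, h3, h4]
  ring

variable {q : ℝ≥0∞} [Fact (1 ≤ q)]

lemma coeff_mulLp_fourierLp (f : CircleLp ∞) (j k : ℤ) :
    coeff q k (mulLp f (fourierLp (T := 1) q j) : CircleLp q) = coeff ∞ (k - j) f := by
  rw [coeff_eq_integral, coeff_eq_integral]
  refine integral_congr_ae ?_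
  filter_upwards [coeFn_mulLp (r := q) f (fourierLp (T := 1) q j), coeFn_fourierLp (T := 1) q j]
    with x h1 h2
  rw [h1, h2, show -(k - j) = -k + j by ring, fourier_add]
  ring

/-- The convolution formula: apply the continuous functional `g ↦ coeff 2 k (f g)` to the Fourier
series of `g`, which converges in `L^2`. -/
lemma hasSum_coeff_mulLp (f : CircleLp ∞) (g : CircleLp 2) (k : ℤ) :
    HasSum (fun j => coeff 2 j g * coeff ∞ (k - j) f) (coeff 2 k (mulLp f g : CircleLp 2)) := by
  have h := ((hasSum_fourier_series_L2 g).map (mulLpL (q := 2) f)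
    (mulLpL f).continuous).map (coeff 2 k) (continuous_coeff 2 k)
  convert! h using 2 with j
  simp only [Function.comp_apply, map_smul, mulLpL_apply, coeff_mulLp_fourierLp, smul_eq_mul]
  rfl

lemma coeff_mulLp_of_neg {f : CircleLp ∞} (hf : f ∈ hardy ∞) {g : CircleLp 2} (hg : g ∈ hardy 2)
    {k : ℤ} (hk : k < 0) : coeff 2 k (mulLp f g : CircleLp 2) = 0 := by
  refine (hasSum_coeff_mulLp f g k).unique ?_
  convert! hasSum_zero using 2 with j
  rcases lt_or_ge j 0 with hj | hj
  · rw [(mem_hardy_iff 2).1 hg j hj, zero_mul]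
  · rw [(mem_hardy_iff ∞).1 hf (k - j) (by lia), mul_zero]

lemma coeff_zero_mulLp {f : CircleLp ∞} (hf : f ∈ hardy ∞) {g : CircleLp 2} (hg : g ∈ hardy 2) :
    coeff 2 0 (mulLp f g : CircleLp 2) = coeff ∞ 0 f * coeff 2 0 g := by
  have h := hasSum_single (f := fun j => coeff 2 j g * coeff ∞ (0 - j) f) 0 fun j hj => by
    rcases lt_or_gt_of_ne hj with hj | hj
    · rw [(mem_hardy_iff 2).1 hg j hj, zero_mul]
    · rw [(mem_hardy_iff ∞).1 hf (0 - j) (by lia), mul_zero]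
  rw [(hasSum_coeff_mulLp f g 0).unique h, sub_zero, mul_comm]

lemma rieszL2_mem (f : CircleLp 2) : rieszL2 f ∈ hardy 2 :=
  Submodule.starProjection_apply_mem _ f

/-- Functions in `H^q`, `1 < q ≤ 2`, are approximated by functions in `H^2`. -/
lemma hardy_induction (hq : 1 < q) (hq2 : q ≤ 2) {S : Set (CircleLp q)} (hS : IsClosed S)
    (h : ∀ f ∈ hardy 2, inclL2 q hq2 f ∈ S) {f : CircleLp q} (hf : f ∈ hardy q) : f ∈ S := by
  obtain ⟨R, hR, hR2⟩ := exists_riesz hq hq2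
  have hqt : q ≠ ∞ := (hq2.trans_lt (by norm_num)).ne
  have hd : DenseRange (ofCont q) := ContinuousMap.toLp_denseRange ℂ arcLength ℂ hqt
  have hRf : R f = f := eq_of_coeff_eq hq fun k => by
    rw [hR]
    split_ifs with hk
    · rfl
    · exact ((mem_hardy_iff q).1 hf k (not_le.1 hk)).symm
  -- `R` sends the dense set of continuous functions into the image of `H^2`, and it fixes `f`.
  have hmem : R f ∈ S := hd.induction_on (p := fun f => R f ∈ S) f (hS.preimage R.continuous)
    fun g => by
      rw [hR2]
      exact h _ (rieszL2_mem _)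
  rwa [hRf] at hmem

lemma mulLp_inclL2_ae (hq2 : q ≤ 2) (f : CircleLp ∞) (g : CircleLp 2) :
    ((mulLp f (inclL2 q hq2 g) : CircleLp q) : UnitAddCircle → ℂ) =ᵐ[arcLength]
      (mulLp f g : CircleLp 2) := by
  filter_upwards [coeFn_mulLp (r := q) f (inclL2 q hq2 g), coeFn_inclL2 q hq2 g,
    coeFn_mulLp (r := 2) f g] with x h1 h2 h3
  rw [h1, h2, h3]

/-- `H^∞ H^q ⊆ H^q`. -/
lemma mulLp_mem_hardy (hq : 1 < q) (hq2 : q ≤ 2) {f : CircleLp ∞} (hf : f ∈ hardy ∞)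
    {g : CircleLp q} (hg : g ∈ hardy q) : (mulLp f g : CircleLp q) ∈ hardy q := by
  refine hardy_induction (S := {g | (mulLp f g : CircleLp q) ∈ hardy q}) hq hq2
    ((isClosed_hardy q).preimage (mulLpL f).continuous) (fun g hg => ?_) hg
  refine (mem_hardy_iff q).2 fun k hk => ?_
  rw [coeff_congr (mulLp_inclL2_ae hq2 f g), coeff_mulLp_of_neg hf hg hk]

/-- The value at the origin is multiplicative. -/
lemma atZero_mulLp (hq : 1 < q) (hq2 : q ≤ 2) {f : CircleLp ∞} (hf : f ∈ hardy ∞)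
    {g : CircleLp q} (hg : g ∈ hardy q) :
    atZero q (mulLp f g) = atZero ∞ f * atZero q g := by
  refine hardy_induction (S := {g | coeff q 0 (mulLp f g) = coeff ∞ 0 f * coeff q 0 g}) hq hq2
    (isClosed_eq ((continuous_coeff q 0).comp (mulLpL f).continuous)
      (continuous_const.mul (continuous_coeff q 0))) (fun g hg => ?_) hg
  change coeff q 0 _ = _ * coeff q 0 _
  rw [coeff_congr (mulLp_inclL2_ae hq2 f g), coeff_congr (coeFn_inclL2 q hq2 g),
    coeff_zero_mulLp hf hg]

end Products

/-! ### Multiplication of columns by powers of `z`. -/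

section Shift

variable (q : ℝ≥0∞)

/-- Multiplication by `z ^ m` on `(L^q)^n`. -/
def colShift {n : ℕ} (m : ℤ) (f : ColLp q n) : ColLp q n :=
  fun i => mulLp (fourierLp (T := 1) ∞ m) (f i)

variable {q}

lemma colShift_colShift_neg {n : ℕ} (m : ℤ) (f : ColLp q n) :
    colShift q m (colShift q (-m) f) = f := by
  funext i
  apply Lp.ext
  filter_upwards [coeFn_mulLp (r := q) (fourierLp (T := 1) ∞ m) (colShift q (-m) f i),
    coeFn_mulLp (r := q) (fourierLp (T := 1) ∞ (-m)) (f i), coeFn_fourierLp (T := 1) ∞ m,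
    coeFn_fourierLp (T := 1) ∞ (-m)] with x h1 h2 h3 h4
  change (mulLp (fourierLp (T := 1) ∞ m) (colShift q (-m) f i) : CircleLp q) x = _
  rw [h1, h3]
  change _ * (mulLp (fourierLp (T := 1) ∞ (-m)) (f i) : CircleLp q) x = _
  rw [h2, h4, ← mul_assoc, ← fourier_add]
  simp

lemma colShift_add {n : ℕ} (m : ℤ) (f g : ColLp q n) :
    colShift q m (f + g) = colShift q m f + colShift q m g := by
  funext i
  exact mulLp_add _ _ _

variable [Fact (1 ≤ q)]

lemma coeff_colShift {n : ℕ} (m k : ℤ) (f : ColLp q n) (i : Fin n) :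
    coeff q k (colShift q m f i) = coeff q (k - m) (f i) :=
  coeff_mulLp_fourier q m k (f i)

lemma matMul_colShift {p s : ℝ≥0∞} [ENNReal.HolderTriple p s q] [Fact (1 ≤ s)] {n : ℕ}
    (A : Matrix (Fin n) (Fin n) (CircleLp p)) (m : ℤ) (f : ColLp s n) :
    (matMul A (colShift s m f) : ColLp q n) = colShift q m (matMul A f) := by
  funext i
  change ∑ j, (mulLp (A i j) (mulLp (fourierLp (T := 1) ∞ m) (f j) : CircleLp s) : CircleLp q) =
    mulLp (fourierLp (T := 1) ∞ m) (∑ j, mulLp (A i j) (f j))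
  simp only [mulLp_mulLp_comm]
  simp only [← mulLpL_apply, map_sum]

lemma colShift_neg_one_mem_hardy {n : ℕ} {f : ColLp q n} (hf : f ∈ colHardy q n)
    (hf0 : colAtZero q n f = 0) : colShift q (-1) f ∈ colHardy q n := by
  intro i _
  refine (mem_hardy_iff q).2 fun k hk => ?_
  rw [coeff_colShift]
  rcases (show k - -1 ≤ 0 by lia).lt_or_eq with h | h
  · exact (mem_hardy_iff q).1 (hf i trivial) _ h
  · rw [h]
    exact congrFun hf0 i

lemma colShift_one_mem_hardy {n : ℕ} {f : ColLp q n} (hf : f ∈ colHardy q n) :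
    colShift q 1 f ∈ colHardy q n := by
  intro i _
  refine (mem_hardy_iff q).2 fun k hk => ?_
  rw [coeff_colShift]
  exact (mem_hardy_iff q).1 (hf i trivial) _ (by lia)

lemma colShift_neg_one_mem_conjHardyZero {n : ℕ} {f : ColLp q n}
    (hf : f ∈ colConjHardyZero q n) : colShift q (-1) f ∈ colConjHardyZero q n := by
  intro i _
  refine (mem_conjHardyZero_iff q).2 fun k hk => ?_
  rw [coeff_colShift]
  exact (mem_conjHardyZero_iff q).1 (hf i trivial) _ (by lia)

end Shift

/-! ### Inner matrix functions and their value at the origin. -/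

section Matrices

lemma continuous_matMul {p s q : ℝ≥0∞} [ENNReal.HolderTriple p s q] [Fact (1 ≤ s)]
    [Fact (1 ≤ q)] {n : ℕ} (A : Matrix (Fin n) (Fin n) (CircleLp p)) :
    Continuous (matMul A : ColLp s n →ₗ[ℂ] ColLp q n) := by
  refine continuous_pi fun i => ?_
  change Continuous fun f : ColLp s n => ∑ j, (mulLp (A i j) (f j) : CircleLp q)
  refine continuous_finsetSum _ fun j _ => ?_
  exact (mulLpL (A i j)).continuous.comp (continuous_apply j)

lemma coeFn_matMul {p s q : ℝ≥0∞} [ENNReal.HolderTriple p s q] {n : ℕ}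
    (A : Matrix (Fin n) (Fin n) (CircleLp p)) (f : ColLp s n) :
    ∀ᵐ x ∂arcLength, ∀ i, ((matMul A f : ColLp q n) i : UnitAddCircle → ℂ) x =
      ((Matrix.of fun i j => (A i j : UnitAddCircle → ℂ) x) *ᵥ fun j => f j x) i := by
  rw [ae_all_iff]
  intro i
  have h := fun j => coeFn_mulLp (r := q) (A i j) (f j)
  filter_upwards [ae_all_iff.2 h, Lp.coeFn_fun_finsetSum Finset.univ fun j => (mulLp (A i j) (f j) : CircleLp q)]
    with x h1 h2
  change (∑ j, (mulLp (A i j) (f j) : CircleLp q) : CircleLp q) x = _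
  rw [h2]
  simp [Matrix.mulVec, dotProduct, h1]

variable {n : ℕ} {Θ : Matrix (Fin n) (Fin n) (CircleLp ∞)}

lemma coeFn_conjTranspose (Θ : Matrix (Fin n) (Fin n) (CircleLp ∞)) :
    ∀ᵐ x ∂arcLength, (Matrix.of fun i j => (Θᴴ i j : UnitAddCircle → ℂ) x) =
      (Matrix.of fun i j => (Θ i j : UnitAddCircle → ℂ) x)ᴴ := by
  have h := fun i j => Lp.coeFn_star (Θ j i)
  simp only [Filter.EventuallyEq, ← ae_all_iff] at h
  filter_upwards [h] with x hx
  ext i j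
  exact hx i j

lemma IsInner.matMul_conjTranspose (hΘ : IsInner Θ) {q : ℝ≥0∞} (f : ColLp q n) :
    (matMul Θ (matMul Θᴴ f : ColLp q n) : ColLp q n) = f := by
  funext i
  apply Lp.ext
  filter_upwards [coeFn_matMul (q := q) Θ (matMul Θᴴ f : ColLp q n), coeFn_matMul (q := q) Θᴴ f,
    coeFn_conjTranspose Θ, hΘ.unitary] with x h1 h2 h3 h4
  rw [h1, funext h2, h3, Matrix.mulVec_mulVec, ← Matrix.star_eq_conjTranspose,
    Matrix.mem_unitaryGroup_iff.1 h4, Matrix.one_mulVec]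

lemma IsInner.conjTranspose_matMul (hΘ : IsInner Θ) {q : ℝ≥0∞} (f : ColLp q n) :
    (matMul Θᴴ (matMul Θ f : ColLp q n) : ColLp q n) = f := by
  funext i
  apply Lp.ext
  filter_upwards [coeFn_matMul (q := q) Θᴴ (matMul Θ f : ColLp q n), coeFn_matMul (q := q) Θ f,
    coeFn_conjTranspose Θ, hΘ.unitary] with x h1 h2 h3 h4
  rw [h1, funext h2, h3, Matrix.mulVec_mulVec, ← Matrix.star_eq_conjTranspose,
    Matrix.mem_unitaryGroup_iff'.1 h4, Matrix.one_mulVec]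

variable {q : ℝ≥0∞} [Fact (1 ≤ q)]

lemma IsInner.matMul_mem_hardy (hΘ : IsInner Θ) (hq : 1 < q) (hq2 : q ≤ 2) {f : ColLp q n}
    (hf : f ∈ colHardy q n) : (matMul Θ f : ColLp q n) ∈ colHardy q n := by
  intro i _
  change ∑ j, (mulLp (Θ i j) (f j) : CircleLp q) ∈ hardy q
  exact Submodule.sum_mem _ fun j _ => mulLp_mem_hardy hq hq2 (hΘ.entry_mem i j) (hf j trivial)

/-- The matrix `Θ(0)`. -/
def valueAtZero (Θ : Matrix (Fin n) (Fin n) (CircleLp ∞)) : Matrix (Fin n) (Fin n) ℂ :=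
  Matrix.of fun i j => atZero ∞ (Θ i j)

lemma IsInner.colAtZero_matMul (hΘ : IsInner Θ) (hq : 1 < q) (hq2 : q ≤ 2) {f : ColLp q n}
    (hf : f ∈ colHardy q n) :
    colAtZero q n (matMul Θ f) = valueAtZero Θ *ᵥ colAtZero q n f := by
  funext i
  change atZero q (∑ j, mulLp (Θ i j) (f j)) = ∑ j, _ * atZero q (f j)
  rw [map_sum]
  exact Finset.sum_congr rfl fun j _ => atZero_mulLp hq hq2 (hΘ.entry_mem i j) (hf j trivial)

/-- `Θ* c` need not be analytic; here `colAtZero` stands for its Fourier coefficient of index `0`.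
-/
lemma colAtZero_conjTranspose_const (Θ : Matrix (Fin n) (Fin n) (CircleLp ∞)) (c : Fin n → ℂ) :
    colAtZero q n (matMul Θᴴ fun i => Lp.const q arcLength (c i)) = (valueAtZero Θ)ᴴ *ᵥ c := by
  funext i
  change atZero q (∑ j, mulLp (Θᴴ i j) (Lp.const q arcLength (c j))) = ∑ j, _ * c j
  rw [map_sum]
  refine Finset.sum_congr rfl fun j _ => ?_
  rw [const_eq_smul_fourierLp, mulLp_smul, map_smul, coeff_mulLp_fourierLp,
    Matrix.conjTranspose_apply, coeff_star, smul_eq_mul, mul_comm]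
  rfl

/-- Taking norms, `‖c‖ ≤ ‖Θ(0)‖² ‖c‖` with `‖Θ(0)‖ < 1`. -/
lemma IsPure.eq_zero (hΘ : IsPure Θ) {c : Fin n → ℂ}
    (hc : c = valueAtZero Θ *ᵥ ((valueAtZero Θ)ᴴ *ᵥ c)) : c = 0 := by
  set T := Matrix.toEuclideanCLM (n := Fin n) (𝕜 := ℂ) (valueAtZero Θ) with hT
  have hT1 : ‖T‖ < 1 := hΘ
  have h1 : WithLp.toLp 2 c = T (star T (WithLp.toLp 2 c)) := by
    rw [hT, ← map_star, Matrix.toEuclideanCLM_toLp, Matrix.toEuclideanCLM_toLp,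
      Matrix.star_eq_conjTranspose, ← hc]
  have h2 : ‖WithLp.toLp 2 c‖ ≤ ‖T‖ * (‖T‖ * ‖WithLp.toLp 2 c‖) := by
    conv_lhs => rw [h1]
    refine (T.le_opNorm _).trans ?_
    gcongr
    refine ((star T).le_opNorm _).trans_eq ?_
    rw [ContinuousLinearMap.star_eq_adjoint, LinearIsometryEquiv.norm_map]
  have h3 : ‖WithLp.toLp 2 c‖ = 0 := by
    by_contra hne
    have hpos : 0 < ‖WithLp.toLp 2 c‖ := (norm_nonneg _).lt_of_ne' hne
    nlinarith [norm_nonneg T, mul_lt_mul_of_pos_right hT1 hpos]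
  simpa using h3

end Matrices

/-! ### Orthogonalising the defect space. -/

section Hilbert

/-- A finite-dimensional space `D` may be replaced by one orthogonal to the closed subspace `M`
without changing `M + D`. -/
lemma exists_isOrtho_sup_eq {E : Type*} [NormedAddCommGroup E] [InnerProductSpace ℂ E]
    [CompleteSpace E] {M D : Submodule ℂ E} (hM : IsClosed (M : Set E)) [FiniteDimensional ℂ D] :
    ∃ D' : Submodule ℂ E, M ⟂ D' ∧ M ⊔ D' = M ⊔ D ∧ FiniteDimensional ℂ D' ∧
      Module.finrank ℂ D' ≤ Module.finrank ℂ D := by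
  have : CompleteSpace M := hM.completeSpace_coe
  let T : E →ₗ[ℂ] E := Mᗮ.starProjection.toLinearMap
  have hT : ∀ x, T x = x - M.starProjection x := fun x => M.starProjection_orthogonal_val x
  -- Each `x ∈ D` differs from its projection onto the orthogonal complement by an element of `M`.
  refine ⟨D.map T, ?_, ?_, inferInstance, Submodule.finrank_map_le T D⟩
  · rw [Submodule.isOrtho_comm, Submodule.isOrtho_iff_le]
    rintro _ ⟨x, -, rfl⟩
    exact Submodule.starProjection_apply_mem _ x
  · refine le_antisymm (sup_le le_sup_left ?_) (sup_le le_sup_left fun x hx => ?_)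
    · rintro _ ⟨x, hx, rfl⟩
      rw [hT]
      exact sub_mem (Submodule.mem_sup_right hx)
        (Submodule.mem_sup_left (Submodule.starProjection_apply_mem _ x))
    · rw [← sub_add_cancel x (M.starProjection x), ← hT]
      exact add_mem (Submodule.mem_sup_right (Submodule.mem_map_of_mem hx))
        (Submodule.mem_sup_left (Submodule.starProjection_apply_mem _ x))

end Hilbert

/-! ### Columns in `(L^2)^n` and division by `z`. -/

section Columns

variable {n : ℕ}

lemma ofColL2_divZ (f : ColL2 n) : ofColL2 n (divZ n f) = colShift 2 (-1) (ofColL2 n f) := rfl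

lemma continuous_ofColL2 : Continuous (ofColL2 n) :=
  PiLp.continuous_ofLp 2 fun _ : Fin n => CircleLp 2

lemma backwardShift_eq_divZ {f : ColL2 n} (hf : colH2AtZero n f = 0) :
    backwardShift n f = divZ n f := by
  rw [backwardShift, hf]
  congr 1
  simp only [Pi.zero_apply, map_zero]
  exact sub_zero f

lemma isClosed_colHardy (q : ℝ≥0∞) [Fact (1 ≤ q)] (n : ℕ) :
    IsClosed (colHardy q n : Set (ColLp q n)) := by
  rw [colHardy, Submodule.coe_pi]
  exact isClosed_set_pi fun _ _ => isClosed_hardy q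

lemma isClosed_colConjHardyZero (q : ℝ≥0∞) [Fact (1 ≤ q)] (n : ℕ) :
    IsClosed (colConjHardyZero q n : Set (ColLp q n)) := by
  rw [colConjHardyZero, Submodule.coe_pi]
  exact isClosed_set_pi fun _ _ => isClosed_conjHardyZero q

lemma divZ_mem_colH2 {f : ColL2 n} (hf : f ∈ colH2 n) (hf0 : colH2AtZero n f = 0) :
    divZ n f ∈ colH2 n :=
  colShift_neg_one_mem_hardy hf hf0

/-- `f(0)` is the coefficient of index `-1` of `f / z`. -/
lemma colH2AtZero_eq_zero_of_divZ_mem {f : ColL2 n} (hf : divZ n f ∈ colH2 n) :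
    colH2AtZero n f = 0 := by
  funext i
  have h := (mem_hardy_iff 2).1 (hf i trivial) (-1) (by norm_num)
  rw [ofColL2_divZ, coeff_colShift] at h
  exact h

end Columns

/-! ### The Toeplitz kernel and its first component. -/

section Kernel

variable {n : ℕ} {p q : ℝ≥0∞} [ENNReal.HolderTriple p 2 q] [Fact (1 ≤ q)]
  {Θ : Matrix (Fin n) (Fin n) (CircleLp ∞)} {G : Matrix (Fin n) (Fin n) (CircleLp p)}

/-- A Riesz projection vanishes exactly on `conj (H_0)`, so the kernel is described without it. -/
lemma mem_toeplitzKer_iff {F : ColL2 n × ColLp q n} :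
    F ∈ toeplitzKer p q Θ G ↔ F.1 ∈ colH2 n ∧ F.2 ∈ colHardy q n ∧
      (matMul Θᴴ (ofColL2 n F.1) : ColLp 2 n) ∈ colConjHardyZero 2 n ∧
      (matMul G (ofColL2 n F.1) + matMul Θ F.2 : ColLp q n) ∈ colConjHardyZero q n := by
  constructor
  · rintro ⟨h1, h2, ⟨-, h3⟩, ⟨-, h4⟩⟩
    refine ⟨h1, h2, ?_, ?_⟩
    · rw [← sub_zero (matMul Θᴴ (ofColL2 n F.1))]
      exact h3
    · rw [← sub_zero (matMul G (ofColL2 n F.1) + matMul Θ F.2)]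
      exact h4
  · rintro ⟨h1, h2, h3, h4⟩
    refine ⟨h1, h2, ⟨zero_mem _, ?_⟩, ⟨zero_mem _, ?_⟩⟩
    · rw [← sub_zero (matMul Θᴴ (ofColL2 n F.1))] at h3
      exact h3
    · rw [← sub_zero (matMul G (ofColL2 n F.1) + matMul Θ F.2)] at h4
      exact h4

omit [Fact (1 ≤ q)] in
lemma exponent_bounds (hp : 2 < p) : 1 < q ∧ q ≤ 2 := by
  have h := ENNReal.HolderTriple.inv_add_inv_eq_inv p 2 q
  have hp' : p⁻¹ < 2⁻¹ := ENNReal.inv_lt_inv.2 hp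
  constructor
  · rw [← ENNReal.inv_lt_inv, inv_one, ← h]
    calc p⁻¹ + 2⁻¹ < 2⁻¹ + 2⁻¹ := ENNReal.add_lt_add_right (by simp) hp'
      _ = 1 := ENNReal.inv_two_add_inv_two
  · rw [← ENNReal.inv_le_inv, ← h]
    exact le_add_self

lemma projFirst_toeplitzKer_le : (toeplitzKer p q Θ G).map (projFirst q n) ≤ colH2 n := by
  rintro _ ⟨F, hF, rfl⟩
  exact (mem_toeplitzKer_iff.1 hF).1

/-- The kernel is closed under division by `z` of the elements vanishing at the origin. -/
lemma divZ_mem_toeplitzKer {F : ColL2 n × ColLp q n} (hF : F ∈ toeplitzKer p q Θ G)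
    (hF0 : pairAtZero q n F = 0) : (divZ n F.1, colShift q (-1) F.2) ∈ toeplitzKer p q Θ G := by
  obtain ⟨h1, h2, h3, h4⟩ := mem_toeplitzKer_iff.1 hF
  refine mem_toeplitzKer_iff.2 ⟨divZ_mem_colH2 h1 (congrArg Prod.fst hF0),
    colShift_neg_one_mem_hardy h2 (congrArg Prod.snd hF0), ?_, ?_⟩
  · rw [ofColL2_divZ, matMul_colShift]
    exact colShift_neg_one_mem_conjHardyZero h3
  · rw [ofColL2_divZ, matMul_colShift, matMul_colShift, ← colShift_add]
    exact colShift_neg_one_mem_conjHardyZero h4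

/-- A projection of a closed subspace need not be closed; here `f₂` is a continuous function of
`f₁`, which turns membership in `M` into closed conditions on `f₁`. -/
lemma isClosed_projFirst_toeplitzKer (hq : 1 < q) (hq2 : q ≤ 2) (hΘ : IsInner Θ) :
    IsClosed ((toeplitzKer p q Θ G).map (projFirst q n) : Set (ColL2 n)) := by
  obtain ⟨R, hR, -⟩ := exists_riesz hq hq2
  let Rn : ColLp q n → ColLp q n := fun f i => R (f i)
  have hRn : Continuous Rn := continuous_pi fun i => R.continuous.comp (continuous_apply i)
  have hRmem : ∀ f, Rn f ∈ colHardy q n := fun f i _ =>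
    (mem_hardy_iff q).2 fun k hk => by rw [hR, if_neg (not_le.2 hk)]
  have hRsub : ∀ f, f - Rn f ∈ colConjHardyZero q n := fun f i _ =>
    (mem_conjHardyZero_iff q).2 fun k hk => by
      rw [Pi.sub_apply, map_sub, hR, if_pos hk, sub_self]
  have hRuniq : ∀ f g : ColLp q n, g ∈ colHardy q n → f - g ∈ colConjHardyZero q n →
      Rn f = g := by
    intro f g hg hfg
    funext i
    refine eq_of_coeff_eq hq fun k => ?_
    rw [hR]
    split_ifs with hk
    · have := (mem_conjHardyZero_iff q).1 (hfg i trivial) k hk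
      rwa [Pi.sub_apply, map_sub, sub_eq_zero] at this
    · exact ((mem_hardy_iff q).1 (hg i trivial) k (not_le.1 hk)).symm
  -- The second kernel equation says `Rn (G f) = -Θ f₂`, so the only candidate is `f₂ = -Θ* Rn (G
  -- f)`, and what remains is that it be analytic.
  have hset : ((toeplitzKer p q Θ G).map (projFirst q n) : Set (ColL2 n)) =
      ofColL2 n ⁻¹' (colHardy 2 n) ∩
      ((fun f => (matMul Θᴴ (ofColL2 n f) : ColLp 2 n)) ⁻¹' (colConjHardyZero 2 n) ∩
        (fun f => (matMul Θᴴ (Rn (matMul G (ofColL2 n f))) : ColLp q n)) ⁻¹' (colHardy q n)) := by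
    ext f
    constructor
    · rintro ⟨F, hF, rfl⟩
      obtain ⟨h1, h2, h3, h4⟩ := mem_toeplitzKer_iff.1 hF
      refine ⟨h1, h3, ?_⟩
      have h5 : Rn (matMul G (ofColL2 n F.1)) = -matMul Θ F.2 := by
        refine hRuniq _ _ (neg_mem (hΘ.matMul_mem_hardy hq hq2 h2)) ?_
        rwa [sub_neg_eq_add]
      change (matMul Θᴴ (Rn (matMul G (ofColL2 n F.1))) : ColLp q n) ∈ colHardy q n
      rw [h5, map_neg, hΘ.conjTranspose_matMul]
      exact neg_mem h2
    · rintro ⟨h1, h2, h3⟩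
      refine ⟨(f, -matMul Θᴴ (Rn (matMul G (ofColL2 n f)))), mem_toeplitzKer_iff.2
        ⟨h1, neg_mem h3, h2, ?_⟩, rfl⟩
      rw [map_neg, hΘ.matMul_conjTranspose, ← sub_eq_add_neg]
      exact hRsub _
  rw [hset]
  refine ((isClosed_colHardy 2 n).preimage continuous_ofColL2).inter
    (((isClosed_colConjHardyZero 2 n).preimage ?_).inter ((isClosed_colHardy q n).preimage ?_))
  · exact (continuous_matMul _).comp continuous_ofColL2
  · exact (continuous_matMul _).comp (hRn.comp ((continuous_matMul _).comp continuous_ofColL2))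

/-- For pure `Θ`, the second component of an element of the kernel whose first component is
divisible by `z` in `P_n (ker T)` vanishes at the origin. -/
lemma colAtZero_snd_eq_zero (hq : 1 < q) (hq2 : q ≤ 2) (hΘ : IsInner Θ) (hpure : IsPure Θ)
    {W F : ColL2 n × ColLp q n} (hW : W ∈ toeplitzKer p q Θ G) (hF : F ∈ toeplitzKer p q Θ G)
    (hWF : divZ n W.1 = F.1) : colAtZero q n W.2 = 0 := by
  obtain ⟨-, hW2, -, hW4⟩ := mem_toeplitzKer_iff.1 hW
  obtain ⟨-, hF2, -, hF4⟩ := mem_toeplitzKer_iff.1 hF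
  have hG : (matMul G (ofColL2 n W.1) : ColLp q n) =
      colShift q 1 (matMul G (ofColL2 n F.1)) := by
    rw [← hWF, ofColL2_divZ, ← matMul_colShift, colShift_colShift_neg]
  set h : ColLp q n := W.2 - colShift q 1 F.2 with hh
  have hmem : h ∈ colHardy q n := sub_mem hW2 (colShift_one_mem_hardy hF2)
  -- The terms in `G` cancel because `W.1 = z F.1`. What is left lies in `conj (H_0) - z conj
  -- (H_0)`, which has no coefficients of positive index.
  have hΘh : (matMul Θ h : ColLp q n) = (matMul G (ofColL2 n W.1) + matMul Θ W.2) -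
      colShift q 1 (matMul G (ofColL2 n F.1) + matMul Θ F.2) := by
    rw [hh, map_sub, matMul_colShift, colShift_add, hG, add_sub_add_left_eq_sub]
  have hΘmem : (matMul Θ h : ColLp q n) ∈ colHardy q n := hΘ.matMul_mem_hardy hq hq2 hmem
  have hconst : (matMul Θ h : ColLp q n) =
      fun i => Lp.const q arcLength (colAtZero q n (matMul Θ h) i) := by
    funext i
    refine eq_of_coeff_eq hq fun k => ?_
    rw [coeff_const]
    rcases lt_trichotomy k 0 with hk | rfl | hk
    · rw [if_neg hk.ne, (mem_hardy_iff q).1 (hΘmem i trivial) k hk]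
    · rfl
    · rw [if_neg hk.ne', hΘh, Pi.sub_apply, map_sub, coeff_colShift,
        (mem_conjHardyZero_iff q).1 (hW4 i trivial) k hk.le,
        (mem_conjHardyZero_iff q).1 (hF4 i trivial) (k - 1) (by lia), sub_zero]
  have hh' : h = matMul Θᴴ fun i => Lp.const q arcLength (colAtZero q n (matMul Θ h) i) := by
    rw [← hconst, hΘ.conjTranspose_matMul]
  -- With `c = Θ h`, one has `h = Θ* c`, so `h(0) = Θ(0)* c` and `c = Θ(0) h(0)`.
  have hc : colAtZero q n (matMul Θ h) = 0 := by
    refine hpure.eq_zero ?_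
    rw [← colAtZero_conjTranspose_const (q := q), ← hh', hΘ.colAtZero_matMul hq hq2 hmem]
  have hh0 : h = 0 := by
    rw [hh', hc]
    simp only [Pi.zero_apply, map_zero]
    exact map_zero (matMul (s := q) (q := q) Θᴴ)
  have hW2' : W.2 = colShift q 1 F.2 := sub_eq_zero.1 hh0
  funext i
  change coeff q 0 (W.2 i) = 0
  rw [hW2', coeff_colShift]
  exact (mem_hardy_iff q).1 (hF2 i trivial) _ (by norm_num)

variable {r : ℕ} {W : Fin r → ColL2 n × ColLp q n}

instance : FiniteDimensional ℂ (defectSpace q W) := by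
  have : FiniteDimensional ℂ (Submodule.span ℂ (Set.range fun i => projFirst q n (W i))) :=
    FiniteDimensional.span_of_finite ℂ (Set.finite_range _)
  exact Submodule.finiteDimensional_inf_left _ _

lemma span_le_toeplitzKer (hW : ∀ i, W i ∈ toeplitzKer p q Θ G) :
    Submodule.span ℂ (Set.range W) ≤ toeplitzKer p q Θ G :=
  Submodule.span_le.2 (Set.range_subset_iff.2 hW)

omit [Fact (1 ≤ q)] in
lemma span_projFirst_eq : Submodule.span ℂ (Set.range fun i => projFirst q n (W i)) =
    (Submodule.span ℂ (Set.range W)).map (projFirst q n) := by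
  rw [Submodule.map_span, ← Set.range_comp]
  rfl

lemma backwardShift_mem_sup (hW : ∀ i, W i ∈ toeplitzKer p q Θ G)
    (hWspan : Submodule.span ℂ (Set.range fun i => pairAtZero q n (W i)) =
      (toeplitzKer p q Θ G).map (pairAtZero q n))
    {f : ColL2 n} (hf : f ∈ (toeplitzKer p q Θ G).map (projFirst q n))
    (hf0 : colH2AtZero n f = 0) :
    backwardShift n f ∈ (toeplitzKer p q Θ G).map (projFirst q n) ⊔ defectSpace q W := by
  obtain ⟨F, hF, rfl⟩ := hf
  have hspan : pairAtZero q n F ∈ (Submodule.span ℂ (Set.range W)).map (pairAtZero q n) := by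
    rw [Submodule.map_span, ← Set.range_comp]
    change _ ∈ Submodule.span ℂ (Set.range fun i => pairAtZero q n (W i))
    rw [hWspan]
    exact Submodule.mem_map_of_mem hF
  obtain ⟨V, hV, hVF⟩ := hspan
  have hVker := span_le_toeplitzKer hW hV
  have hdiff := divZ_mem_toeplitzKer (sub_mem hF hVker) (by rw [map_sub, hVF, sub_self])
  have hdiffM := Submodule.mem_map_of_mem (f := projFirst q n) hdiff
  have hsplit : divZ n F.1 = divZ n (F - V).1 + divZ n V.1 := by
    rw [← map_add, Prod.fst_sub, sub_add_cancel]
  rw [backwardShift_eq_divZ hf0]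
  change divZ n F.1 ∈ _
  rw [hsplit]
  refine add_mem (Submodule.mem_sup_left hdiffM) (Submodule.mem_sup_right ⟨?_, ?_⟩)
  · refine Submodule.mem_map_of_mem ?_
    rw [span_projFirst_eq]
    exact Submodule.mem_map_of_mem hV
  -- `V.1 / z` is analytic as a difference of two analytic columns.
  · have h1 : divZ n F.1 ∈ colH2 n := divZ_mem_colH2 (mem_toeplitzKer_iff.1 hF).1 hf0
    have h2 := projFirst_toeplitzKer_le hdiffM
    have h3 : divZ n V.1 = divZ n F.1 - divZ n (F - V).1 := by rw [hsplit, add_sub_cancel_left]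
    rw [SetLike.mem_coe, h3]
    exact sub_mem h1 h2

/-- If `V.1 / z` lies in `M` for `V` in the span of the `W i`, analyticity gives `V.1(0) = 0` and
purity gives `V.2(0) = 0`; independence of the values then kills `V`. -/
lemma disjoint_defectSpace (hq : 1 < q) (hq2 : q ≤ 2) (hΘ : IsInner Θ) (hpure : IsPure Θ)
    (hW : ∀ i, W i ∈ toeplitzKer p q Θ G)
    (hWli : LinearIndependent ℂ fun i => pairAtZero q n (W i)) :
    Disjoint ((toeplitzKer p q Θ G).map (projFirst q n)) (defectSpace q W) := by
  rw [Submodule.disjoint_def]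
  rintro f ⟨F, hF, rfl⟩ ⟨⟨g, hg, hgf⟩, hf⟩
  rw [SetLike.mem_coe, span_projFirst_eq] at hg
  obtain ⟨V, hV, rfl⟩ := hg
  have hVker := span_le_toeplitzKer hW hV
  have h1 : colH2AtZero n V.1 = 0 := colH2AtZero_eq_zero_of_divZ_mem (by rwa [← hgf] at hf)
  have h2 : colAtZero q n V.2 = 0 := colAtZero_snd_eq_zero hq hq2 hΘ hpure hVker hF hgf
  have h3 : pairAtZero q n V = 0 := Prod.ext h1 h2
  obtain ⟨c, rfl⟩ := (Submodule.mem_span_range_iff_exists_fun ℂ).1 hV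
  rw [map_sum] at h3
  simp only [map_smul] at h3
  have hc := Fintype.linearIndependent_iff.1 hWli c h3
  rw [← hgf]
  simp [hc]

end Kernel

end MTTO

end

/-! ### The main theorem. -/

theorem mainTheorem8 (n : ℕ) (p q : ENNReal) (hp : 2 < p) [ENNReal.HolderTriple p 2 q]
    [Fact (1 ≤ q)]
    (Θ : Matrix (Fin n) (Fin n) (MTTO.CircleLp ⊤)) (hΘ : MTTO.IsInner Θ)
    (G : Matrix (Fin n) (Fin n) (MTTO.CircleLp p))
    (r : ℕ) (W : Fin r → MTTO.ColL2 n × MTTO.ColLp q n)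
    (hW : ∀ i, W i ∈ MTTO.toeplitzKer p q Θ G)
    (hWli : LinearIndependent ℂ fun i => MTTO.pairAtZero q n (W i))
    (hWspan : Submodule.span ℂ (Set.range fun i => MTTO.pairAtZero q n (W i)) =
      (MTTO.toeplitzKer p q Θ G).map (MTTO.pairAtZero q n)) :
    MTTO.IsNearlyInvariant ((MTTO.toeplitzKer p q Θ G).map (MTTO.projFirst q n))
      (MTTO.defectSpace q W) ∧
    (MTTO.IsPure Θ →
      Disjoint ((MTTO.toeplitzKer p q Θ G).map (MTTO.projFirst q n)) (MTTO.defectSpace q W)) ∧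
    ∃ D' : Submodule ℂ (MTTO.ColL2 n),
      MTTO.IsNearlyInvariant ((MTTO.toeplitzKer p q Θ G).map (MTTO.projFirst q n)) D' ∧
      (MTTO.toeplitzKer p q Θ G).map (MTTO.projFirst q n) ⟂ D' ∧
      (MTTO.toeplitzKer p q Θ G).map (MTTO.projFirst q n) ⊔ D' =
        (MTTO.toeplitzKer p q Θ G).map (MTTO.projFirst q n) ⊔ MTTO.defectSpace q W ∧
      Module.finrank ℂ D' ≤ Module.finrank ℂ (MTTO.defectSpace q W) := by
  obtain ⟨hq, hq2⟩ := MTTO.exponent_bounds (q := q) hp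
  have hM : MTTO.IsNearlyInvariant ((MTTO.toeplitzKer p q Θ G).map (MTTO.projFirst q n))
      (MTTO.defectSpace q W) :=
    { le_H2 := MTTO.projFirst_toeplitzKer_le
      isClosed := MTTO.isClosed_projFirst_toeplitzKer hq hq2 hΘ
      defect_le_H2 := inf_le_right
      finiteDimensional := inferInstance
      shift_mem := fun f hf hf0 => MTTO.backwardShift_mem_sup hW hWspan hf hf0 }
  obtain ⟨D', hD'M, hsup, hfin, hrank⟩ :=
    MTTO.exists_isOrtho_sup_eq (D := MTTO.defectSpace q W) hM.isClosed
  refine ⟨hM, fun hpure => MTTO.disjoint_defectSpace hq hq2 hΘ hpure hW hWli, D',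
    { le_H2 := hM.le_H2
      isClosed := hM.isClosed
      -- `D'` lies in `M + D' = M + D`, and both `M` and `D` are contained in `(H^2)^n`.
      defect_le_H2 := le_sup_right.trans (hsup.le.trans (sup_le hM.le_H2 hM.defect_le_H2))
      finiteDimensional := hfin
      shift_mem := fun f hf hf0 => hsup ▸ hM.shift_mem f hf hf0 }, hD'M, hsup, hrank⟩
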